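/- For graphs $G$ and $F$ write $G\to F$ if every colouring of the edges of $G$ with two colours yields a monochromatic copy of $F$, and let $\hat R(F)=\min\{|E(G)| : G \text{ a finite graph},\ G\to F\}$ be the size-Ramsey number of $F$. Let $P_n$ be the path on $n$ vertices, and let $\mathcal G_{N,d}$ be a uniformly random simple $d$-regular graph on $N$ labelled vertices. Let $c=5.219$ and $d=30$. Then a.a.s. $\mathcal G_{cn,d}\to P_n$; that is, the probability that $\mathcal G_{N(n),d}\to P_n$ tends to $1$ as $n\to\infty$, whichever way $cn$ is rounded to an integer $N(n)\in\{\lfloor cn\rfloor,\lceil cn\rceil\}$. Consequently, $\hat R(P_n)<78.3\,n$ for all sufficiently large $n$. -/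

import Mathlib

open Filter Topology MeasureTheory ProbabilityTheory

/-- `Arrows G F r` is the arrow relation `G → (F)_r`: every colouring of the edges of `G` with
`r` colours has a colour class that contains a (not necessarily induced) copy of `F`. -/
def Arrows {V W : Type*} (G : SimpleGraph V) (F : SimpleGraph W) (r : ℕ) : Prop :=
  ∀ C : G.EdgeLabeling (Fin r), ∃ k : Fin r, F.IsContained (C.labelGraph k)

/-- The numbers of edges of the finite graphs `G` with `G → (F)_r`. -/
def arrowSizes {W : Type*} (F : SimpleGraph W) (r : ℕ) : Set ℕ :=
  {m | ∃ (N : ℕ) (G : SimpleGraph (Fin N)), Arrows G F r ∧ G.edgeSet.ncard = m}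

/-- The size-Ramsey number `R̂(F, r)`, the least number of edges of a finite graph `G` with
`G → (F)_r`. (As for every infimum in `ℕ`, the value is attained if `arrowSizes F r` is nonempty,
and is `0` by convention otherwise.) -/
noncomputable def sizeRamsey {W : Type*} (F : SimpleGraph W) (r : ℕ) : ℕ :=
  sInf (arrowSizes F r)

/-- On finitely many vertices, single graphs are measurable events (so all events are). -/
instance {N : ℕ} : MeasurableSingletonClass (SimpleGraph (Fin N)) where
  measurableSet_singleton G := by
    have h : MeasurableSet ((SimpleGraph.edgeSet : SimpleGraph (Fin N) → Set (Sym2 (Fin N))) ⁻¹'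
        {G.edgeSet}) := SimpleGraph.measurable_edgeSet (measurableSet_singleton _)
    convert h using 1
    ext H
    simp

open scoped Classical in
/-- The random `d`-regular graph `𝒢_{N,d}`: the uniform distribution on the set of all simple
`d`-regular graphs with vertex set `Fin N`. It is a probability measure as soon as such a graph
exists, and the zero measure otherwise. -/
noncomputable def randomRegularGraph (N d : ℕ) : Measure (SimpleGraph (Fin N)) :=
  uniformOn {G | G.IsRegularOfDegree d}

/-! The deterministic half turns a bad colouring into a large gap in the graph. Suppose a
2-colouring of a graph on N vertices has no monochromatic path on n vertices. A depth-first search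
in the first colour is stopped when the explored set S and the untouched set T are equally large.
The remaining vertices form a path, so there are fewer than n of them, and no edge of the first
colour joins S to T. A second search, in the bipartite graph of second-colour edges between S and T,
loses fewer than n further vertices. It leaves two disjoint s-sets with no edge of either colour
between them, where 4s is about N - 2n (`exists_disjoint_not_adj_of_not_arrows`). It remains to show
that a.a.s. the random 30-regular graph has no such pair of sets.

The random half is a first-moment bound in the pairing model. A fixed matching of the 30N half-edges
is conjugated by a uniform permutation; conditioned on being simple, it gives the uniform regular
graph (`card_perm_simple_eq`). The matching is simple with at least inverse polynomial probability
(`factorial_le_card_isSimplePairing`): on average only boundedly many half-edges are bad, and each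
can be repaired by a switching at polynomial cost. This crude bound suffices because the expected
number of gaps decays exponentially.

Matchings with no edge between S and T are counted by a generating function in which z marks the
half-edges outside both sets, evaluated at z = 3.7 (`card_filter_no_edge_between_le`). The union
bound and Stirling-type estimates give the growth rate `gapExponent` at σ = (c - 2)/(4c) =
3219/20876, which is just negative (`gapExponent_neg`). The edge count is then at most 15 · 5.219 n
= 78.285 n. -/

/-! ### Depth-first search and gaps forced by colourings -/

/-- Every stage of a depth-first search of `H` on the vertex set `U`: the explored vertices `S`, the
untouched vertices `T` and the current path `P` partition `U`, and no edge joins `S` to `T`. -/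
theorem exists_dfs_state {V : Type*} [DecidableEq V] (H : SimpleGraph V) (U : Finset V) (j : ℕ)
    (hj : j ≤ 2 * U.card) :
    ∃ (S T : Finset V) (P : List V), (∀ v, v ∈ U ↔ v ∈ S ∨ v ∈ T ∨ v ∈ P) ∧
      (∀ v ∈ S, v ∉ T ∧ v ∉ P) ∧ (∀ v ∈ T, v ∉ P) ∧ P.Nodup ∧ P.IsChain H.Adj ∧
      (∀ x ∈ S, ∀ y ∈ T, ¬ H.Adj x y) ∧ S.card + T.card + P.length = U.card ∧
      2 * S.card + P.length = j := by
  -- `j` is the number of moves made. Moving a vertex from `T` to the path, or from the path to `S`,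
  -- raises `2 * S.card + P.length` by exactly one, so no value up to `2 * U.card` is skipped. The
  -- head of `P` is the vertex being searched from.
  induction j with
  | zero => exact ⟨∅, U, [], by simp⟩
  | succ j ih =>
    obtain ⟨S, T, P, hU, hS, hT, hnd, hch, hno, hc, hj'⟩ := ih (by omega)
    rcases P with _ | ⟨v, P⟩
    · have hTne : T.Nonempty := by
        rw [← Finset.card_pos]
        simp at hc hj'
        omega
      obtain ⟨w, hw⟩ := hTne
      have hTc := Finset.card_erase_add_one hw
      refine ⟨S, T.erase w, [w], ?_, ?_, ?_, by simp, by simp, ?_, ?_, ?_⟩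
      · grind
      · grind
      · grind
      · grind
      · simp at hc ⊢; omega
      · simp at hj' ⊢; omega
    · by_cases h : ∃ w ∈ T, H.Adj v w
      · obtain ⟨w, hw, hvw⟩ := h
        have hTc := Finset.card_erase_add_one hw
        refine ⟨S, T.erase w, w :: v :: P, ?_, ?_, ?_, ?_, ?_, ?_, ?_, ?_⟩
        · grind
        · grind
        · grind
        · grind
        · exact List.isChain_cons_cons.2 ⟨hvw.symm, hch⟩
        · grind
        · simp at hc ⊢; omega
        · simp at hj' ⊢; omega
      · push Not at h
        have hvS : v ∉ S := fun hv => (hS v hv).2 (by simp)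
        refine ⟨insert v S, T, P, ?_, ?_, ?_, ?_, ?_, ?_, ?_, ?_⟩
        · grind
        · grind
        · grind
        · grind
        · exact hch.tail
        · grind
        · rw [Finset.card_insert_of_notMem hvS]; simp at hc ⊢; omega
        · rw [Finset.card_insert_of_notMem hvS]; simp at hj' ⊢; omega

theorem pathGraph_isContained_of_isChain {V : Type*} {H : SimpleGraph V} {n : ℕ} {P : List V}
    (hnd : P.Nodup) (hch : P.IsChain H.Adj) (hn : n ≤ P.length) :
    (SimpleGraph.pathGraph n).IsContained H := by
  have key : ∀ u v : Fin n, u.val + 1 = v.val →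
      H.Adj (P.get (u.castLE hn)) (P.get (v.castLE hn)) := by
    intro u v huv
    have := List.isChain_iff_getElem.1 hch u.val (by omega)
    simpa [huv] using this
  refine ⟨⟨⟨fun i => P.get (i.castLE hn), ?_⟩, ?_⟩⟩
  · intro u v huv
    rcases SimpleGraph.pathGraph_adj.1 huv with h | h
    · exact key u v h
    · exact (key v u h).symm
  · intro u v huv
    have := hnd.injective_get huv
    simpa [Fin.ext_iff] using this

/-- Along a path whose edges all join `S` to its complement, the two sides alternate. -/
theorem card_filter_le_of_isChain_alternating {V : Type*} [DecidableEq V] (S : Finset V)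
    (P : List V) (hch : P.IsChain (fun x y => x ∈ S ↔ y ∉ S)) :
    ∀ b : Bool, (P.head?.map (fun v => decide (v ∈ S)) = some b ∨ P = []) →
      (P.filter (fun v => decide (v ∈ S) = b)).length ≤
        (P.filter (fun v => ¬ decide (v ∈ S) = b)).length + 1 ∧
      (P.filter (fun v => ¬ decide (v ∈ S) = b)).length ≤
        (P.filter (fun v => decide (v ∈ S) = b)).length := by
  induction P with
  | nil => simp
  | cons v P ih =>
    intro b hb
    have hb' : decide (v ∈ S) = b := by simpa using hb
    have := ih hch.tail (!b) (by
      rcases P with _ | ⟨w, P⟩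
      · simp
      · left
        have := (List.isChain_cons_cons.1 hch).1
        cases b <;> simp at hb' ⊢ <;> tauto)
    have e1 : ∀ u : V, (decide (u ∈ S) = !b) ↔ ¬ (decide (u ∈ S) = b) := by
      intro u; cases b <;> simp
    simp only [e1, not_not] at this
    rw [List.filter_cons_of_pos (by simpa using hb'), List.filter_cons_of_neg (by simpa using hb')]
    simp only [List.length_cons]
    omega

theorem card_eq_of_partition {V : Type*} [DecidableEq V] {U S T A : Finset V} {P : List V}
    (hU : ∀ v, v ∈ U ↔ v ∈ S ∨ v ∈ T ∨ v ∈ P) (hS : ∀ v ∈ S, v ∉ T ∧ v ∉ P)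
    (hT : ∀ v ∈ T, v ∉ P) (hnd : P.Nodup) (hA : A ⊆ U) :
    A.card = (S ∩ A).card + (T ∩ A).card + (P.filter (fun v => decide (v ∈ A))).length := by
  have h1 : A = (S ∩ A) ∪ (T ∩ A) ∪ (P.filter (fun v => decide (v ∈ A))).toFinset := by
    ext v
    have := hU v
    have := @hA v
    simp only [Finset.mem_union, Finset.mem_inter, List.mem_toFinset, List.mem_filter]
    grind
  conv_lhs => rw [h1]
  rw [Finset.card_union_of_disjoint, Finset.card_union_of_disjoint,
    List.toFinset_card_of_nodup (hnd.filter _)]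
  · rw [Finset.disjoint_left]; grind
  · rw [Finset.disjoint_left]
    intro v hv hv'
    simp only [Finset.mem_union, Finset.mem_inter, List.mem_toFinset, List.mem_filter] at hv hv'
    grind

/-- If some 2-colouring of `G` has no monochromatic path on `n` vertices, then `G` has two disjoint
sets of `s` vertices with no edge between them, whenever `4 * s + 2 * n ≤ N + 2`. -/
theorem exists_disjoint_not_adj_of_not_arrows {N n s : ℕ} (hs : 4 * s + 2 * n ≤ N + 2)
    (G : SimpleGraph (Fin N)) (hG : ¬ Arrows G (SimpleGraph.pathGraph n) 2) :
    ∃ S T : Finset (Fin N), S.card = s ∧ T.card = s ∧ Disjoint S T ∧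
      ∀ x ∈ S, ∀ y ∈ T, ¬ G.Adj x y := by
  unfold Arrows at hG
  push Not at hG
  obtain ⟨C, hC⟩ := hG
  have hcol : ∀ x y, G.Adj x y → (C.labelGraph 0).Adj x y ∨ (C.labelGraph 1).Adj x y := by
    intro x y h
    simp only [SimpleGraph.EdgeLabeling.labelGraph_adj]
    rcases Fin.exists_fin_two.1 ⟨C ⟨s(x, y), h⟩, rfl⟩ with h0 | h0
    · exact Or.inl ⟨h, h0⟩
    · exact Or.inr ⟨h, h0⟩
  -- After exactly `N` moves, 2|S| + |P| = N = |S| + |T| + |P|, hence |S| = |T|.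
  obtain ⟨S, T, P, hU, hS, hT, hnd, hch, hno, hc, hj⟩ :=
    exists_dfs_state (C.labelGraph 0) Finset.univ N (by simp; omega)
  have hP : P.length < n := by
    by_contra h
    exact (hC 0).false (pathGraph_isContained_of_isChain hnd hch (by omega)).some
  simp only [Finset.card_univ, Fintype.card_fin] at hc
  let H : SimpleGraph (Fin N) :=
    { Adj := fun x y => (C.labelGraph 1).Adj x y ∧ (x ∈ S ∧ y ∈ T ∨ x ∈ T ∧ y ∈ S)
      symm := ⟨fun x y h => ⟨h.1.symm, by tauto⟩⟩
      loopless := ⟨fun x h => h.1.ne rfl⟩ }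
  have hH : ∀ x y, H.Adj x y ↔ (C.labelGraph 1).Adj x y ∧ (x ∈ S ∧ y ∈ T ∨ x ∈ T ∧ y ∈ S) :=
    fun _ _ => Iff.rfl
  have hST : Disjoint S T := Finset.disjoint_left.2 fun v hv => (hS v hv).1
  have hSTc : (S ∪ T).card = S.card + T.card := Finset.card_union_of_disjoint hST
  -- Since 2|S| = |S ∪ T|, this stopping time again gives |S'| = |T'|.
  obtain ⟨S', T', P', hU', hS', hT', hnd', hch', hno', hc', hj'⟩ :=
    exists_dfs_state H (S ∪ T) (2 * S.card) (by omega)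
  have hP' : P'.length < n := by
    by_contra h
    refine (hC 1).false (pathGraph_isContained_of_isChain hnd' (hch'.imp ?_) (by omega)).some
    exact fun _ _ h => ((hH _ _).1 h).1
  have hcS := card_eq_of_partition hU' hS' hT' hnd' (A := S) Finset.subset_union_left
  have hcT := card_eq_of_partition hU' hS' hT' hnd' (A := T) Finset.subset_union_right
  have hcS' := card_eq_of_partition (A := S')
    (fun v => show v ∈ S' ↔ v ∈ S' ∩ S ∨ v ∈ S' ∩ T ∨ v ∈ ([] : List (Fin N)) by
      have := hU' v; grind) (by grind) (by simp) (by simp) (Finset.Subset.refl _)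
  have hcT' := card_eq_of_partition (A := T')
    (fun v => show v ∈ T' ↔ v ∈ T' ∩ S ∨ v ∈ T' ∩ T ∨ v ∈ ([] : List (Fin N)) by
      have := hU' v; grind) (by grind) (by simp) (by simp) (Finset.Subset.refl _)
  simp only [List.filter_nil, List.length_nil, add_zero] at hcS' hcT'
  rw [Finset.inter_eq_left.2 Finset.inter_subset_left,
    Finset.inter_eq_left.2 Finset.inter_subset_left] at hcS' hcT'
  have hfT : (P'.filter (fun v => decide (v ∈ T))).length =
      (P'.filter (fun v => decide (v ∉ S))).length := by
    congr 1
    apply List.filter_congr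
    intro v hv
    have := hU' v
    have := hS v
    grind
  have hlen : P'.length = (P'.filter (fun v => decide (v ∈ S))).length +
      (P'.filter (fun v => decide (v ∉ S))).length := by
    have := List.length_eq_length_filter_add (l := P') (fun v => decide (v ∈ S))
    simpa using this
  have halt : (P'.filter (fun v => decide (v ∈ S))).length ≤
        (P'.filter (fun v => decide (v ∉ S))).length + 1 ∧
      (P'.filter (fun v => decide (v ∉ S))).length ≤
        (P'.filter (fun v => decide (v ∈ S))).length + 1 := by
    have h := card_filter_le_of_isChain_alternating S P' (hch'.imp (by
      intro x y h
      have := ((hH x y).1 h).2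
      have := hS x
      have := hS y
      grind))
    rcases P' with _ | ⟨v, P'⟩
    · simp
    · by_cases hv : v ∈ S
      · have := h true (by simp [hv])
        simp only [decide_eq_true_eq] at this
        omega
      · have := h false (by simp [hv])
        simp only [decide_eq_false_iff_not, not_not] at this
        omega
  have hmain : ∀ A B : Finset (Fin N), A ⊆ S' → B ⊆ T' → (A ⊆ S ∧ B ⊆ T ∨ A ⊆ T ∧ B ⊆ S) →
      s ≤ A.card → s ≤ B.card → ∃ S T : Finset (Fin N), S.card = s ∧ T.card = s ∧ Disjoint S T ∧
      ∀ x ∈ S, ∀ y ∈ T, ¬ G.Adj x y := by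
    intro A B hA hB hAB hAc hBc
    obtain ⟨A₁, hA₁, hA₁c⟩ := Finset.exists_subset_card_eq hAc
    obtain ⟨B₁, hB₁, hB₁c⟩ := Finset.exists_subset_card_eq hBc
    refine ⟨A₁, B₁, hA₁c, hB₁c, ?_, ?_⟩
    · rw [Finset.disjoint_left]
      intro v hv hv'
      exact (hS' v (hA (hA₁ hv))).1 (hB (hB₁ hv'))
    · intro x hx y hy hxy
      have hxA := hA₁ hx
      have hyB := hB₁ hy
      have hno1 := hno' x (hA hxA) y (hB hyB)
      rw [hH] at hno1
      rcases hAB with ⟨h1, h2⟩ | ⟨h1, h2⟩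
      · have := hno x (h1 hxA) y (h2 hyB)
        rcases hcol x y hxy with h | h
        · exact this h
        · exact hno1 ⟨h, Or.inl ⟨h1 hxA, h2 hyB⟩⟩
      · have := hno y (h2 hyB) x (h1 hxA)
        rcases hcol x y hxy with h | h
        · exact this h.symm
        · exact hno1 ⟨h, Or.inr ⟨h1 hxA, h2 hyB⟩⟩
  -- From |S| = |T|, |S'| = |T'| and the alternation of `P'`, the number 2(|S' ∩ S| - |T' ∩ T|) is
  -- at most 1 in absolute value, so by parity |S' ∩ S| = |T' ∩ T| and likewise |S' ∩ T| = |T' ∩ S|.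
  -- The path bounds give |S'| ≥ 2s, so one of the two pairs is large enough.
  by_cases hcase : s ≤ (S' ∩ S).card
  · exact hmain (S' ∩ S) (T' ∩ T) Finset.inter_subset_left Finset.inter_subset_left
      (Or.inl ⟨Finset.inter_subset_right, Finset.inter_subset_right⟩) hcase (by omega)
  · exact hmain (S' ∩ T) (T' ∩ S) Finset.inter_subset_left Finset.inter_subset_left
      (Or.inr ⟨Finset.inter_subset_right, Finset.inter_subset_right⟩) (by omega) (by omega)

/-! ### The pairing model and uniform regular graphs -/

/-- Fixed-point-free involutions, seen as perfect matchings. -/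
def IsPairing {X : Type*} (σ : Equiv.Perm X) : Prop :=
  (∀ x, σ (σ x) = x) ∧ ∀ x, σ x ≠ x

/-- A matching of the half-edges `V × D` that produces neither loops nor multiple edges. -/
def IsSimplePairing {V D : Type*} (σ : Equiv.Perm (V × D)) : Prop :=
  (∀ x, (σ x).1 ≠ x.1) ∧ ∀ x y, x.1 = y.1 → (σ x).1 = (σ y).1 → x = y

/-- The graph on `V` obtained from a matching of the half-edges `V × D`. -/
def pairingGraph {V D : Type*} (σ : Equiv.Perm (V × D)) : SimpleGraph V :=
  SimpleGraph.fromRel fun u v => ∃ i, (σ (u, i)).1 = v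

theorem pairingGraph_adj {V D : Type*} {σ : Equiv.Perm (V × D)} (hσ : IsPairing σ)
    (hs : IsSimplePairing σ) (u v : V) :
    (pairingGraph σ).Adj u v ↔ ∃ i, (σ (u, i)).1 = v := by
  have hsymm : ∀ u v : V, (∃ i, (σ (u, i)).1 = v) → ∃ i, (σ (v, i)).1 = u := by
    rintro u v ⟨i, rfl⟩
    exact ⟨(σ (u, i)).2, by simp [hσ.1]⟩
  rw [pairingGraph, SimpleGraph.fromRel_adj]
  constructor
  · rintro ⟨-, h | h⟩
    · exact h
    · exact hsymm _ _ h
  · intro h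
    refine ⟨?_, Or.inl h⟩
    obtain ⟨i, rfl⟩ := h
    exact (hs.1 (u, i)).symm

theorem isPairing_conj {X : Type*} {τ : Equiv.Perm X} (hτ : IsPairing τ) (g : Equiv.Perm X) :
    IsPairing (g * τ * g⁻¹) := by
  constructor
  · intro x; simp [hτ.1]
  · intro x h
    have h' : g (τ (g⁻¹ x)) = g (g⁻¹ x) := by simpa using h
    exact hτ.2 _ (g.injective h')

/-- A pairing has cycle type 2, 2, ..., 2 without fixed points, and cycle type determines the
conjugacy class. Hence conjugating one fixed pairing reaches all of them. -/
theorem exists_conj_eq_of_isPairing {X : Type*} [Finite X] {σ τ : Equiv.Perm X}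
    (hσ : IsPairing σ) (hτ : IsPairing τ) : ∃ h : Equiv.Perm X, h * σ * h⁻¹ = τ := by
  classical
  have := Fintype.ofFinite X
  have key : ∀ ρ : Equiv.Perm X, IsPairing ρ →
      ∃ m, ρ.cycleType = Multiset.replicate m 2 ∧ m * 2 = Fintype.card X := by
    intro ρ hρ
    have h2 : ρ ^ 2 = 1 := by ext x; simp [pow_two, hρ.1]
    refine ⟨_, Equiv.Perm.cycleType_of_pow_prime_eq_one h2, ?_⟩
    have h3 := ρ.sum_cycleType
    have h4 : ρ.support = Finset.univ := by ext x; simp [hρ.2 x]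
    rw [h4, Finset.card_univ] at h3
    conv_lhs at h3 => rw [Equiv.Perm.cycleType_of_pow_prime_eq_one h2]
    simpa using h3
  obtain ⟨m, hm, hm'⟩ := key σ hσ
  obtain ⟨m', hm₁, hm₁'⟩ := key τ hτ
  have : m = m' := by omega
  subst this
  exact isConj_iff.1 (Equiv.Perm.isConj_iff_cycleType_eq.2 (hm.trans hm₁.symm))

/-- The permutations carrying `τ` to `σ` form a coset of the centralizer of `τ`. So a uniform
permutation induces a uniform pairing, and counting permutations replaces counting pairings. -/
theorem card_conj_eq {X : Type*} [Finite X] {σ τ : Equiv.Perm X}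
    (hσ : IsPairing σ) (hτ : IsPairing τ) :
    Nat.card {g : Equiv.Perm X // g * τ * g⁻¹ = σ} =
      Nat.card {g : Equiv.Perm X // g * τ * g⁻¹ = τ} := by
  obtain ⟨h, hh⟩ := exists_conj_eq_of_isPairing hσ hτ
  refine Nat.card_congr ⟨fun g => ⟨h * g.1, ?_⟩, fun g => ⟨h⁻¹ * g.1, ?_⟩, ?_, ?_⟩
  · have hg : h * (g.1 * τ * g.1⁻¹) * h⁻¹ = τ := by rw [g.2, hh]
    conv_rhs => rw [← hg]
    group
  · have hg := g.2
    have : σ = h⁻¹ * τ * h := by rw [← hh]; group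
    rw [this]
    calc h⁻¹ * g.1 * τ * (h⁻¹ * g.1)⁻¹ = h⁻¹ * (g.1 * τ * g.1⁻¹) * h := by group
      _ = _ := by rw [hg]
  · intro g; simp
  · intro g; simp

/-- The half-edges at `v` label the neighbours of `v`. -/
noncomputable def neighborEquivOfPairing {V D : Type*} {σ : Equiv.Perm (V × D)}
    (hσ : IsPairing σ) (hs : IsSimplePairing σ) {G : SimpleGraph V} (hG : pairingGraph σ = G)
    (v : V) : D ≃ G.neighborSet v :=
  Equiv.ofBijective
    (fun i => ⟨(σ (v, i)).1, by
      have h := pairingGraph_adj hσ hs v (σ (v, i)).1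
      rw [hG] at h
      exact h.2 ⟨i, rfl⟩⟩) (by
    constructor
    · intro i j hij
      have := hs.2 (v, i) (v, j) rfl (congrArg Subtype.val hij)
      simpa using this
    · rintro ⟨w, hw⟩
      have h := pairingGraph_adj hσ hs v w
      rw [hG] at h
      obtain ⟨i, hi⟩ := h.1 hw
      exact ⟨i, Subtype.ext hi⟩)

/-- Join the half-edge of `v` labelled by the neighbour `w` to that of `w` labelled by `v`. -/
def pairNeighbors {V D : Type*} {G : SimpleGraph V} (b : ∀ v, D ≃ G.neighborSet v)
    (x : V × D) : V × D :=
  ((b x.1 x.2).1, (b (b x.1 x.2).1).symm ⟨x.1, (b x.1 x.2).2.symm⟩)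

theorem pairNeighbors_eq {V D : Type*} {G : SimpleGraph V} (b : ∀ v, D ≃ G.neighborSet v)
    (v w : V) (i j : D) (hw : (b v i).1 = w) (hv : (b w j).1 = v) :
    pairNeighbors b (v, i) = (w, j) := by
  subst hw
  refine Prod.ext rfl ?_
  simp only [pairNeighbors]
  rw [Equiv.symm_apply_eq]
  exact Subtype.ext hv.symm

theorem involutive_pairNeighbors {V D : Type*} {G : SimpleGraph V}
    (b : ∀ v, D ≃ G.neighborSet v) : Function.Involutive (pairNeighbors b) := by
  rintro ⟨v, i⟩
  exact pairNeighbors_eq b _ _ _ _ (by simp) rfl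

theorem isSimplePairing_pairNeighbors {V D : Type*} {G : SimpleGraph V}
    (b : ∀ v, D ≃ G.neighborSet v) : IsSimplePairing (involutive_pairNeighbors b).toPerm := by
  constructor
  · rintro ⟨v, i⟩
    exact (b v i).2.ne'
  · rintro ⟨v, i⟩ ⟨w, j⟩ (rfl : v = w) h
    have : b v i = b v j := Subtype.ext h
    simpa using this

theorem isPairing_pairNeighbors {V D : Type*} {G : SimpleGraph V}
    (b : ∀ v, D ≃ G.neighborSet v) : IsPairing (involutive_pairNeighbors b).toPerm :=
  ⟨involutive_pairNeighbors b, fun x hx => (isSimplePairing_pairNeighbors b).1 x (by rw [hx])⟩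

theorem pairingGraph_pairNeighbors {V D : Type*} {G : SimpleGraph V}
    (b : ∀ v, D ≃ G.neighborSet v) : pairingGraph (involutive_pairNeighbors b).toPerm = G := by
  ext u v
  rw [pairingGraph_adj (isPairing_pairNeighbors b) (isSimplePairing_pairNeighbors b)]
  constructor
  · rintro ⟨i, rfl⟩
    exact (b u i).2
  · intro h
    exact ⟨(b u).symm ⟨v, h⟩, by simp [pairNeighbors]⟩

/-- The pairings that give a fixed simple graph correspond to labellings of the neighbourhoods. -/
noncomputable def pairingFiberEquiv {V D : Type*} (G : SimpleGraph V) :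
    {σ : Equiv.Perm (V × D) // IsPairing σ ∧ IsSimplePairing σ ∧ pairingGraph σ = G} ≃
      (∀ v, D ≃ G.neighborSet v) where
  toFun σ v := neighborEquivOfPairing σ.2.1 σ.2.2.1 σ.2.2.2 v
  invFun b := ⟨(involutive_pairNeighbors b).toPerm, isPairing_pairNeighbors b,
    isSimplePairing_pairNeighbors b, pairingGraph_pairNeighbors b⟩
  left_inv := by
    rintro ⟨σ, h1, h2, h3⟩
    apply Subtype.ext
    apply Equiv.ext
    rintro ⟨v, i⟩
    exact pairNeighbors_eq _ _ _ _ _ rfl (congrArg Prod.fst (h1.1 (v, i)))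
  right_inv := by
    intro b
    funext v
    ext i
    rfl

/-- A regular graph comes from one simple pairing per family of labellings of its neighbourhoods,
and each pairing comes from equally many permutations. What matters is that the product does not
depend on `G`. -/
theorem card_perm_pairingGraph_eq {V D : Type*} [Finite V] [Finite D]
    {τ : Equiv.Perm (V × D)} (hτ : IsPairing τ) (G : SimpleGraph V)
    (hG : ∀ v, Nat.card (G.neighborSet v) = Nat.card D) :
    Nat.card {g : Equiv.Perm (V × D) // IsSimplePairing (g * τ * g⁻¹) ∧
        pairingGraph (g * τ * g⁻¹) = G} =
      (Nat.card D).factorial ^ Nat.card V * Nat.card {g : Equiv.Perm (V × D) // g * τ * g⁻¹ = τ} := by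
  classical
  have := Fintype.ofFinite V
  have := Fintype.ofFinite D
  have e : {g : Equiv.Perm (V × D) // IsSimplePairing (g * τ * g⁻¹) ∧
        pairingGraph (g * τ * g⁻¹) = G} ≃
      Σ σ : {σ : Equiv.Perm (V × D) // IsPairing σ ∧ IsSimplePairing σ ∧ pairingGraph σ = G},
        {g : Equiv.Perm (V × D) // g * τ * g⁻¹ = σ.1} :=
    { toFun := fun g => ⟨⟨g.1 * τ * g.1⁻¹, isPairing_conj hτ _, g.2.1, g.2.2⟩, ⟨g.1, rfl⟩⟩
      invFun := fun p => ⟨p.2.1, by rw [p.2.2]; exact ⟨p.1.2.2.1, p.1.2.2.2⟩⟩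
      left_inv := fun g => rfl
      right_inv := by
        rintro ⟨⟨σ, hσ⟩, ⟨g, hg⟩⟩
        dsimp only at hg
        subst hg
        rfl }
  rw [Nat.card_congr e, Nat.card_sigma]
  simp_rw [fun σ : {σ : Equiv.Perm (V × D) //
    IsPairing σ ∧ IsSimplePairing σ ∧ pairingGraph σ = G} => card_conj_eq σ.2.1 hτ]
  rw [Finset.sum_const, Finset.card_univ, smul_eq_mul, ← Nat.card_eq_fintype_card,
    Nat.card_congr (pairingFiberEquiv G), Nat.card_pi]
  congr 1
  rw [Finset.prod_congr rfl (fun v _ => ?_), Finset.prod_const, Finset.card_univ,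
    ← Nat.card_eq_fintype_card]
  have hv := hG v
  rw [Nat.card_eq_fintype_card, Nat.card_eq_fintype_card] at hv
  rw [Nat.card_eq_fintype_card, Fintype.card_equiv (Fintype.equivOfCardEq hv.symm),
    Nat.card_eq_fintype_card]

theorem card_neighborSet_pairingGraph {V D : Type*} {σ : Equiv.Perm (V × D)} (hσ : IsPairing σ)
    (hs : IsSimplePairing σ) (v : V) : Nat.card ((pairingGraph σ).neighborSet v) = Nat.card D :=
  (Nat.card_congr (pairingFiberEquiv (pairingGraph σ) ⟨σ, hσ, hs, rfl⟩ v)).symm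

/-- The graph of a uniformly random simple matching is a uniformly random regular graph. -/
theorem card_perm_simple_eq {V D : Type*} [Finite V] [Finite D]
    {τ : Equiv.Perm (V × D)} (hτ : IsPairing τ) (Q : SimpleGraph V → Prop) :
    Nat.card {g : Equiv.Perm (V × D) // IsSimplePairing (g * τ * g⁻¹) ∧
        Q (pairingGraph (g * τ * g⁻¹))} =
      Nat.card {G : SimpleGraph V // (∀ v, Nat.card (G.neighborSet v) = Nat.card D) ∧ Q G} *
        ((Nat.card D).factorial ^ Nat.card V *
          Nat.card {g : Equiv.Perm (V × D) // g * τ * g⁻¹ = τ}) := by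
  classical
  have := Fintype.ofFinite V
  have := Fintype.ofFinite D
  have e : {g : Equiv.Perm (V × D) // IsSimplePairing (g * τ * g⁻¹) ∧
        Q (pairingGraph (g * τ * g⁻¹))} ≃
      Σ G : {G : SimpleGraph V // (∀ v, Nat.card (G.neighborSet v) = Nat.card D) ∧ Q G},
        {g : Equiv.Perm (V × D) // IsSimplePairing (g * τ * g⁻¹) ∧
        pairingGraph (g * τ * g⁻¹) = G} :=
    { toFun := fun g => ⟨⟨pairingGraph (g.1 * τ * g.1⁻¹),
        card_neighborSet_pairingGraph (isPairing_conj hτ _) g.2.1, g.2.2⟩, ⟨g.1, g.2.1, rfl⟩⟩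
      invFun := fun p => ⟨p.2.1, p.2.2.1, by rw [p.2.2.2]; exact p.1.2.2⟩
      left_inv := fun g => rfl
      right_inv := by
        rintro ⟨⟨G, hG⟩, ⟨g, hg, hg'⟩⟩
        dsimp only at hg'
        subst hg'
        rfl }
  have := Fintype.ofFinite {G : SimpleGraph V // (∀ v, Nat.card (G.neighborSet v) = Nat.card D) ∧ Q G}
  rw [Nat.card_congr e, Nat.card_sigma]
  simp_rw [fun G : {G : SimpleGraph V // (∀ v, Nat.card (G.neighborSet v) = Nat.card D) ∧ Q G} =>
    card_perm_pairingGraph_eq hτ G.1 G.2.1]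
  rw [Finset.sum_const, Finset.card_univ, smul_eq_mul, ← Nat.card_eq_fintype_card]

/-! ### Switchings and the probability of simplicity -/

open scoped Classical in
/-- The half-edges that lie in a loop or in a multiple edge. -/
noncomputable def badHalfEdges {V D : Type*} [Fintype V] [Fintype D] (σ : Equiv.Perm (V × D)) :
    Finset (V × D) :=
  {x | (σ x).1 = x.1 ∨ ∃ y, y ≠ x ∧ y.1 = x.1 ∧ (σ y).1 = (σ x).1}

theorem mem_badHalfEdges {V D : Type*} [Fintype V] [Fintype D] {σ : Equiv.Perm (V × D)}
    {x : V × D} : x ∈ badHalfEdges σ ↔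
      (σ x).1 = x.1 ∨ ∃ y, y ≠ x ∧ y.1 = x.1 ∧ (σ y).1 = (σ x).1 := by
  simp [badHalfEdges]

theorem isSimplePairing_iff_badHalfEdges_eq_empty {V D : Type*} [Fintype V] [Fintype D]
    {σ : Equiv.Perm (V × D)} : IsSimplePairing σ ↔ badHalfEdges σ = ∅ := by
  rw [Finset.eq_empty_iff_forall_notMem]
  simp only [mem_badHalfEdges, IsSimplePairing, not_or, not_exists, not_and]
  constructor
  · rintro ⟨h1, h2⟩ x
    exact ⟨h1 x, fun y hy h h' => hy (h2 y x h h')⟩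
  · intro h
    refine ⟨fun x => (h x).1, fun x y hxy hxy' => ?_⟩
    by_contra hne
    exact (h y).2 x hne hxy hxy'

/-- Switching a bad half-edge with a suitable one repairs it and creates no new bad ones. -/
theorem exists_swap_card_badHalfEdges_lt {V D : Type*} [Fintype V] [Fintype D]
    [DecidableEq V] [DecidableEq D] {σ : Equiv.Perm (V × D)} (hσ : IsPairing σ) {x : V × D}
    (hx : x ∈ badHalfEdges σ)
    (hc : (badHalfEdges σ).card + 4 * (Fintype.card D + 1) * Fintype.card D
      < Fintype.card (V × D)) :
    ∃ y, (badHalfEdges (Equiv.swap x y * σ * (Equiv.swap x y)⁻¹)).card <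
      (badHalfEdges σ).card := by
  -- `Z` consists of both ends of the edge at `x` and all their neighbours.
  set Z : Finset V := insert x.1 (Finset.univ.image fun i => (σ (x.1, i)).1) ∪
    insert (σ x).1 (Finset.univ.image fun i => (σ ((σ x).1, i)).1) with hZ
  have hZc : Z.card ≤ 2 * (Fintype.card D + 1) := by
    have h1 : ∀ v w : V, (insert w (Finset.univ.image fun i => (σ (v, i)).1)).card ≤
        Fintype.card D + 1 := fun v w =>
      (Finset.card_insert_le _ _).trans (Nat.succ_le_succ Finset.card_image_le)
    have := Finset.card_union_le (insert x.1 (Finset.univ.image fun i => (σ (x.1, i)).1))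
      (insert (σ x).1 (Finset.univ.image fun i => (σ ((σ x).1, i)).1))
    have h4 := h1 x.1 x.1
    have h5 := h1 (σ x).1 (σ x).1
    rw [← hZ] at this
    linarith
  have hZ1 : x.1 ∈ Z := by simp [hZ]
  have hZ2 : (σ x).1 ∈ Z := by simp [hZ]
  have hZ3 : ∀ z, z.1 = x.1 → (σ z).1 ∈ Z := by
    rintro ⟨v, i⟩ rfl
    simp [hZ]
  have hZ4 : ∀ z, z.1 = (σ x).1 → (σ z).1 ∈ Z := by
    rintro ⟨v, i⟩ h
    simp only at h
    subst h
    simp [hZ]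
  -- The edge at `y` must be good with both ends outside `Z`. This excludes the bad half-edges and
  -- at most 2|Z||D| others, which is the term 4(|D| + 1)|D| in `hc`.
  obtain ⟨y, hy⟩ : ∃ y, y ∉ badHalfEdges σ ∪ (Z ×ˢ Finset.univ) ∪
      (Z ×ˢ (Finset.univ : Finset D)).image σ := by
    by_contra! h
    have h1 := Finset.card_union_le (badHalfEdges σ ∪ (Z ×ˢ Finset.univ))
      ((Z ×ˢ (Finset.univ : Finset D)).image σ)
    have h2 := Finset.card_union_le (badHalfEdges σ) (Z ×ˢ (Finset.univ : Finset D))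
    have h3 : ((Z ×ˢ (Finset.univ : Finset D)).image σ).card ≤ _ := Finset.card_image_le
    rw [(Finset.eq_univ_iff_forall).2 h, Finset.card_univ] at h1
    rw [Finset.card_product, Finset.card_univ] at h2 h3
    have h4 := Nat.mul_le_mul_right (Fintype.card D) hZc
    nlinarith
  have hyb : y ∉ badHalfEdges σ := fun h => hy (by simp [h])
  have hyZ : y.1 ∉ Z := fun h => hy (by
    rw [Finset.mem_union, Finset.mem_union, Finset.mem_product]; simp [h])
  have hyZ' : (σ y).1 ∉ Z := fun h => hy (by
    rw [Finset.mem_union]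
    exact Or.inr (Finset.mem_image.2 ⟨σ y, by simp [h], hσ.1 y⟩))
  refine ⟨y, Finset.card_lt_card (Finset.ssubset_iff_of_subset ?_ |>.2 ⟨x, hx, ?_⟩)⟩
  all_goals
    have hyx : y.1 ≠ x.1 := fun h => hyZ (h ▸ hZ1)
    have hyx' : y.1 ≠ (σ x).1 := fun h => hyZ (h ▸ hZ2)
    have hy'x : (σ y).1 ≠ x.1 := fun h => hyZ' (h ▸ hZ1)
    have hy'x' : (σ y).1 ≠ (σ x).1 := fun h => hyZ' (h ▸ hZ2)
    have hy'y : (σ y).1 ≠ y.1 := fun h => hyb (mem_badHalfEdges.2 (Or.inl h))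
    have n1 : ∀ w, w.1 = x.1 → (σ w).1 ≠ y.1 ∧ (σ w).1 ≠ (σ y).1 := fun w hw =>
      ⟨fun h => hyZ (h ▸ hZ3 w hw), fun h => hyZ' (h ▸ hZ3 w hw)⟩
    have n2 : ∀ w, w.1 = (σ x).1 → (σ w).1 ≠ y.1 ∧ (σ w).1 ≠ (σ y).1 := fun w hw =>
      ⟨fun h => hyZ (h ▸ hZ4 w hw), fun h => hyZ' (h ▸ hZ4 w hw)⟩
    have n3 : ∀ w, w.1 = y.1 → (σ w).1 ≠ x.1 ∧ (σ w).1 ≠ (σ x).1 := fun w hw =>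
      ⟨fun h => (n1 _ h).1 (by rw [hσ.1]; exact hw), fun h => (n2 _ h).1 (by rw [hσ.1]; exact hw)⟩
    have n4 : ∀ w, w.1 = (σ y).1 → (σ w).1 ≠ x.1 ∧ (σ w).1 ≠ (σ x).1 := fun w hw =>
      ⟨fun h => (n1 _ h).2 (by rw [hσ.1]; exact hw), fun h => (n2 _ h).2 (by rw [hσ.1]; exact hw)⟩
    have hcase : ∀ z, (z = x ∧ (Equiv.swap x y * σ * (Equiv.swap x y)⁻¹) z = σ y) ∨
        (z = y ∧ (Equiv.swap x y * σ * (Equiv.swap x y)⁻¹) z = σ x) ∨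
        (z = σ x ∧ (Equiv.swap x y * σ * (Equiv.swap x y)⁻¹) z = y) ∨
        (z = σ y ∧ (Equiv.swap x y * σ * (Equiv.swap x y)⁻¹) z = x) ∨
        (z ≠ x ∧ z ≠ y ∧ z ≠ σ x ∧ z ≠ σ y ∧
          (Equiv.swap x y * σ * (Equiv.swap x y)⁻¹) z = σ z) := by
      intro z
      simp only [Equiv.Perm.mul_apply, Equiv.swap_inv]
      by_cases h1 : z = x
      · left
        subst h1
        rw [Equiv.swap_apply_left, Equiv.swap_apply_of_ne_of_ne (fun h => hy'x (by rw [h]))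
          (hσ.2 y)]
        simp
      by_cases h2 : z = y
      · right; left
        subst h2
        rw [Equiv.swap_apply_right, Equiv.swap_apply_of_ne_of_ne (hσ.2 x)
          (fun h => hyx' (by rw [h]))]
        simp
      rw [Equiv.swap_apply_of_ne_of_ne h1 h2]
      by_cases h3 : z = σ x
      · right; right; left
        subst h3
        rw [hσ.1, Equiv.swap_apply_left]
        simp
      by_cases h4 : z = σ y
      · right; right; right; left
        subst h4
        rw [hσ.1, Equiv.swap_apply_right]
        simp
      · right; right; right; right
        refine ⟨h1, h2, h3, h4, Equiv.swap_apply_of_ne_of_ne ?_ ?_⟩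
        · rintro rfl; exact h3 (hσ.1 z).symm
        · rintro rfl; exact h4 (hσ.1 z).symm
    clear hyb hyZ hyZ' hy hZ1 hZ2 hZ3 hZ4 hZc
    clear_value Z
    clear hZ hc
    generalize Equiv.swap x y * σ * (Equiv.swap x y)⁻¹ = ρ at hcase ⊢
    -- The switching replaces the edges x–σx and y–σy by x–σy and y–σx. By `n1`–`n4` no edge of `σ`
    -- joins an end of the first to an end of the second, so the new edges are neither loops nor
    -- parallel to old ones. They are not parallel to each other because y–σy is not a loop.
    have key : ∀ z ∈ badHalfEdges ρ, z ∈ badHalfEdges σ ∧ z ≠ x := by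
      intro z hz
      rw [mem_badHalfEdges] at hz
      by_contra hcon
      rw [mem_badHalfEdges] at hcon
      have hz' := hcase z
      have m1 := n1 z
      have m2 := n2 z
      have m3 := n3 z
      have m4 := n4 z
      rcases hz with hz | ⟨w, hwz, hw1, hw2⟩
      · clear n1 n2 n3 n4 hcase
        grind
      · have hw' := hcase w
        have hcon' : ¬ ((σ w).1 = (σ z).1 ∧ z ≠ x) := fun h => hcon ⟨Or.inr ⟨w, hwz, hw1, h.1⟩, h.2⟩
        have k1 := n1 w
        have k2 := n2 w
        have k3 := n3 w
        have k4 := n4 w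
        clear n1 n2 n3 n4 hcase hcon hσ hx
        generalize σ w = sw at *
        generalize σ z = sz at *
        generalize σ x = sx at *
        generalize σ y = sy at *
        generalize ρ w = rw at *
        generalize ρ z = rz at *
        obtain ⟨x1, x2⟩ := x
        obtain ⟨y1, y2⟩ := y
        obtain ⟨w1, w2⟩ := w
        obtain ⟨z1, z2⟩ := z
        simp only [ne_eq, Prod.mk.injEq] at *
        rcases hz' with hz' | hz' | hz' | hz' | hz' <;>
        rcases hw' with hw' | hw' | hw' | hw' | hw' <;>
        grind
  · exact fun z hz => (key z hz).1
  · exact fun h => (key x h).2 rfl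

/-- Every permutation with at most b + 1 bad half-edges is a transposition times one with at most b.
There are at most |V × D|² transpositions to choose from, so each repair costs that factor. -/
theorem card_filter_badHalfEdges_le {V D : Type*} [Fintype V] [Fintype D]
    [DecidableEq V] [DecidableEq D] {τ : Equiv.Perm (V × D)} (hτ : IsPairing τ) (b : ℕ)
    (hb : b + 4 * (Fintype.card D + 1) * Fintype.card D < Fintype.card (V × D)) :
    (Finset.univ.filter fun g : Equiv.Perm (V × D) =>
      (badHalfEdges (g * τ * g⁻¹)).card ≤ b).card ≤
    (Fintype.card (V × D) ^ 2) ^ b * (Finset.univ.filter fun g : Equiv.Perm (V × D) =>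
      (badHalfEdges (g * τ * g⁻¹)).card ≤ 0).card := by
  induction b with
  | zero => simp
  | succ b ih =>
    have hsub : (Finset.univ.filter fun g : Equiv.Perm (V × D) =>
        (badHalfEdges (g * τ * g⁻¹)).card ≤ b + 1) ⊆
        Finset.image₂ (fun (p : (V × D) × (V × D)) (g : Equiv.Perm (V × D)) =>
          Equiv.swap p.1 p.2 * g) Finset.univ
        (Finset.univ.filter fun g : Equiv.Perm (V × D) =>
          (badHalfEdges (g * τ * g⁻¹)).card ≤ b) := by
      intro g hg
      simp only [Finset.mem_filter, Finset.mem_univ, true_and] at hg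
      rw [Finset.mem_image₂]
      by_cases hgb : (badHalfEdges (g * τ * g⁻¹)).card ≤ b
      · have hX : Nonempty (V × D) := Fintype.card_pos_iff.1 (by omega)
        exact ⟨(hX.some, hX.some), Finset.mem_univ _, g, by simpa using hgb, by simp; rfl⟩
      · have hne : (badHalfEdges (g * τ * g⁻¹)).Nonempty := by
          rw [← Finset.card_pos]; omega
        obtain ⟨x, hx⟩ := hne
        obtain ⟨y, hy⟩ := exists_swap_card_badHalfEdges_lt (isPairing_conj hτ g) hx (by omega)
        refine ⟨(x, y), Finset.mem_univ _, Equiv.swap x y * g, ?_, ?_⟩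
        · simp only [Finset.mem_filter, Finset.mem_univ, true_and]
          have : Equiv.swap x y * g * τ * (Equiv.swap x y * g)⁻¹ =
            Equiv.swap x y * (g * τ * g⁻¹) * (Equiv.swap x y)⁻¹ := by group
          rw [this]
          omega
        · rw [← mul_assoc, Equiv.swap_mul_self, one_mul]
    calc _ ≤ _ := Finset.card_le_card hsub
      _ ≤ _ := Finset.card_image₂_le _ _ _
      _ ≤ (Fintype.card (V × D) ^ 2) * ((Fintype.card (V × D) ^ 2) ^ b *
          (Finset.univ.filter fun g : Equiv.Perm (V × D) =>
      (badHalfEdges (g * τ * g⁻¹)).card ≤ 0).card) := by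
        rw [Finset.card_univ, Fintype.card_prod (V × D), ← pow_two]
        exact Nat.mul_le_mul_left _ (ih (by omega))
      _ = _ := by rw [pow_succ]; ring

/-- A uniformly random permutation maps `r` given points to a uniformly random `r`-tuple of distinct
points. -/
theorem card_filter_perm_mul_descFactorial {X : Type*} [Fintype X] [DecidableEq X] {r : ℕ}
    (e : Fin r ↪ X) (A : Finset (Fin r ↪ X)) :
    (Finset.univ.filter fun g : Equiv.Perm X => e.trans g.toEmbedding ∈ A).card *
      (Fintype.card X).descFactorial r = A.card * (Fintype.card X).factorial := by
  -- The symmetric group is transitive on `r`-tuples of distinct points, so left multiplication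
  -- identifies any two fibres.
  have hfib : ∀ f : Fin r ↪ X,
      (Finset.univ.filter fun g : Equiv.Perm X => e.trans g.toEmbedding = f).card =
      (Finset.univ.filter fun g : Equiv.Perm X => e.trans g.toEmbedding = e).card := by
    intro f
    obtain ⟨h, hh⟩ : ∃ h : Equiv.Perm X, ∀ i, h (e i) = f i := by
      have := Equiv.Perm.isMultiplyPretransitive X r
      obtain ⟨h, hh⟩ := MulAction.exists_smul_eq (Equiv.Perm X) e f
      exact ⟨h, fun i => by rw [← hh]; rfl⟩
    symm
    refine Finset.card_bij (fun g _ => h * g) ?_ ?_ ?_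
    · intro g hg
      simp only [Finset.mem_filter, Finset.mem_univ, true_and, Function.Embedding.ext_iff,
        Function.Embedding.trans_apply, Equiv.coe_toEmbedding, Equiv.Perm.mul_apply] at hg ⊢
      intro i; rw [hg, hh]
    · intro g _ g' _ hgg'
      exact mul_left_cancel hgg'
    · intro g hg
      refine ⟨h⁻¹ * g, ?_, by simp⟩
      simp only [Finset.mem_filter, Finset.mem_univ, true_and, Function.Embedding.ext_iff,
        Function.Embedding.trans_apply, Equiv.coe_toEmbedding, Equiv.Perm.mul_apply] at hg ⊢
      intro i; rw [hg, Equiv.Perm.inv_eq_iff_eq, hh]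
  have hsum : ∀ A : Finset (Fin r ↪ X),
      (Finset.univ.filter fun g : Equiv.Perm X => e.trans g.toEmbedding ∈ A).card =
      A.card * (Finset.univ.filter fun g : Equiv.Perm X => e.trans g.toEmbedding = e).card := by
    intro A
    rw [Finset.card_eq_sum_card_fiberwise (f := fun g : Equiv.Perm X => e.trans g.toEmbedding)
      (t := A) (by intro g hg; simpa using hg), ← smul_eq_mul, ← Finset.sum_const]
    refine Finset.sum_congr rfl fun f hf => ?_
    rw [← hfib f]
    congr 1
    ext g
    simp only [Finset.mem_filter, Finset.mem_univ, true_and]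
    exact ⟨fun h => h.2, fun h => ⟨h ▸ hf, h⟩⟩
  have huniv := hsum Finset.univ
  simp only [Finset.mem_univ, Finset.filter_true, Finset.card_univ, Fintype.card_perm,
    Fintype.card_embedding_eq, Fintype.card_fin] at huniv
  rw [hsum A, huniv]
  ring

/-- Among the permutations, few send a given half-edge to a loop. -/
theorem card_filter_loop_mul_le {V D : Type*} [Fintype V] [Fintype D]
    [DecidableEq V] [DecidableEq D] (hM : 6 ≤ Fintype.card (V × D)) {p q : V × D} (hpq : p ≠ q) :
    (Finset.univ.filter fun g : Equiv.Perm (V × D) => (g q).1 = (g p).1).card *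
      Fintype.card (V × D) ≤ 2 * Fintype.card D * (Fintype.card (V × D)).factorial := by
  set M := Fintype.card (V × D) with hMdef
  let e : Fin 2 ↪ V × D := ⟨![p, q], by
    intro i j hij; fin_cases i <;> fin_cases j <;> simp_all⟩
  let A : Finset (Fin 2 ↪ V × D) := Finset.univ.filter fun f => (f 1).1 = (f 0).1
  have hA : A.card ≤ M * Fintype.card D := by
    have : A.card ≤ (Finset.univ : Finset ((V × D) × D)).card := by
      refine Finset.card_le_card_of_injOn (fun f => (f 0, (f 1).2)) (fun _ _ => Finset.mem_univ _) ?_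
      intro f hf f' hf' h
      simp only [A, Finset.coe_filter, Finset.mem_univ, true_and, Set.mem_ofPred_eq] at hf hf'
      simp only [Prod.mk.injEq] at h
      ext1 i
      fin_cases i
      · exact h.1
      · exact Prod.ext (by simp only [Fin.mk_one]; rw [hf, hf', h.1]) h.2
    rwa [Finset.card_univ, Fintype.card_prod (V × D)] at this
  have h := card_filter_perm_mul_descFactorial e A
  have h1 : (Finset.univ.filter fun g : Equiv.Perm (V × D) => e.trans g.toEmbedding ∈ A) =
      Finset.univ.filter fun g : Equiv.Perm (V × D) => (g q).1 = (g p).1 := by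
    ext g; simp [A]; rfl
  rw [h1] at h
  generalize (Finset.univ.filter fun g : Equiv.Perm (V × D) => (g q).1 = (g p).1).card = c at h ⊢
  rw [← hMdef] at h
  have hd : M * M ≤ 2 * M.descFactorial 2 := by
    obtain ⟨m, hm⟩ := Nat.exists_eq_add_of_le hM
    rw [hm]
    simp only [Nat.descFactorial_succ, Nat.descFactorial_zero, mul_one, Nat.sub_zero]
    have : 6 + m - 1 = 5 + m := by omega
    rw [this]; nlinarith
  have hpos : 0 < M := by omega
  refine Nat.le_of_mul_le_mul_right (c := M) ?_ hpos
  calc c * M * M = c * (M * M) := by ring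
    _ ≤ c * (2 * M.descFactorial 2) := Nat.mul_le_mul_left _ hd
    _ = 2 * (c * M.descFactorial 2) := by ring
    _ = 2 * (A.card * M.factorial) := by rw [h]
    _ ≤ 2 * (M * Fintype.card D * M.factorial) := by gcongr
    _ = _ := by ring

/-- Among the permutations, few make two given edges parallel. -/
theorem card_filter_parallel_mul_le {V D : Type*} [Fintype V] [Fintype D]
    [DecidableEq V] [DecidableEq D] (hM : 6 ≤ Fintype.card (V × D)) {p p' q q' : V × D}
    (h01 : p ≠ p') (h02 : p ≠ q) (h03 : p ≠ q') (h12 : p' ≠ q) (h13 : p' ≠ q') (h23 : q ≠ q') :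
    (Finset.univ.filter fun g : Equiv.Perm (V × D) =>
      (g q).1 = (g p).1 ∧ (g q').1 = (g p').1).card * Fintype.card (V × D) ^ 2 ≤
      8 * Fintype.card D ^ 2 * (Fintype.card (V × D)).factorial := by
  set M := Fintype.card (V × D) with hMdef
  let e : Fin 4 ↪ V × D := ⟨![p, p', q, q'], by
    intro i j hij; fin_cases i <;> fin_cases j <;> simp_all⟩
  let A : Finset (Fin 4 ↪ V × D) :=
    Finset.univ.filter fun f => (f 2).1 = (f 0).1 ∧ (f 3).1 = (f 1).1
  have hA : A.card ≤ (M * Fintype.card D) * (M * Fintype.card D) := by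
    have : A.card ≤ (Finset.univ : Finset (((V × D) × D) × ((V × D) × D))).card := by
      refine Finset.card_le_card_of_injOn (fun f => ((f 0, (f 2).2), (f 1, (f 3).2)))
        (fun _ _ => Finset.mem_univ _) ?_
      intro f hf f' hf' h
      simp only [A, Finset.coe_filter, Finset.mem_univ, true_and, Set.mem_ofPred_eq] at hf hf'
      simp only [Prod.mk.injEq] at h
      ext1 i
      fin_cases i
      · exact h.1.1
      · exact h.2.1
      · exact Prod.ext (hf.1.trans ((congrArg Prod.fst h.1.1).trans hf'.1.symm)) h.1.2
      · exact Prod.ext (hf.2.trans ((congrArg Prod.fst h.2.1).trans hf'.2.symm)) h.2.2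
    rwa [Finset.card_univ, Fintype.card_prod ((V × D) × D), Fintype.card_prod (V × D)] at this
  have h := card_filter_perm_mul_descFactorial e A
  have h1 : (Finset.univ.filter fun g : Equiv.Perm (V × D) => e.trans g.toEmbedding ∈ A) =
      Finset.univ.filter fun g : Equiv.Perm (V × D) =>
        (g q).1 = (g p).1 ∧ (g q').1 = (g p').1 := by
    ext g; simp [A]; rfl
  rw [h1] at h
  generalize (Finset.univ.filter fun g : Equiv.Perm (V × D) =>
    (g q).1 = (g p).1 ∧ (g q').1 = (g p').1).card = c at h ⊢
  rw [← hMdef] at h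
  have hd : M ^ 4 ≤ 8 * M.descFactorial 4 := by
    obtain ⟨m, hm⟩ := Nat.exists_eq_add_of_le hM
    rw [hm]
    simp only [Nat.descFactorial_succ, Nat.descFactorial_zero, mul_one, Nat.sub_zero]
    have e1 : 6 + m - 1 = 5 + m := by omega
    have e2 : 6 + m - 2 = 4 + m := by omega
    have e3 : 6 + m - 3 = 3 + m := by omega
    rw [e1, e2, e3]
    calc (6 + m) ^ 4 = (6 + m) * ((6 + m) * (6 + m) * (6 + m)) := by ring
      _ ≤ (2 * (3 + m)) * ((2 * (4 + m)) * (2 * (5 + m)) * (6 + m)) := by gcongr <;> omega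
      _ = _ := by ring
  have hpos : 0 < M ^ 2 := by positivity
  refine Nat.le_of_mul_le_mul_right (c := M ^ 2) ?_ hpos
  calc c * M ^ 2 * M ^ 2 = c * M ^ 4 := by ring
    _ ≤ c * (8 * M.descFactorial 4) := Nat.mul_le_mul_left _ hd
    _ = 8 * (c * M.descFactorial 4) := by ring
    _ = 8 * (A.card * M.factorial) := by rw [h]
    _ ≤ 8 * ((M * Fintype.card D) * (M * Fintype.card D) * M.factorial) := by gcongr
    _ = _ := by ring

/-- The average number of bad half-edges is bounded. -/
theorem sum_card_badHalfEdges_le {V D : Type*} [Fintype V] [Fintype D]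
    [DecidableEq V] [DecidableEq D] {τ : Equiv.Perm (V × D)} (hτ : IsPairing τ)
    (hM : 6 ≤ Fintype.card (V × D)) :
    ∑ g : Equiv.Perm (V × D), (badHalfEdges (g * τ * g⁻¹)).card ≤
      10 * Fintype.card D ^ 2 * (Fintype.card (V × D)).factorial := by
  have hpt : ∀ g : Equiv.Perm (V × D), (badHalfEdges (g * τ * g⁻¹)).card ≤
      (∑ p, if (g (τ p)).1 = (g p).1 then 1 else 0) +
      ∑ p, ∑ q ∈ Finset.univ.filter (fun q => q ≠ p ∧ q ≠ τ p),
        if (g q).1 = (g p).1 ∧ (g (τ q)).1 = (g (τ p)).1 then 1 else 0 := by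
    intro g
    rw [← Finset.sum_add_distrib]
    calc (badHalfEdges (g * τ * g⁻¹)).card
        = ∑ x, if x ∈ badHalfEdges (g * τ * g⁻¹) then 1 else 0 := by simp
      _ = ∑ p, if g p ∈ badHalfEdges (g * τ * g⁻¹) then 1 else 0 :=
        (Equiv.sum_comp g fun x => if x ∈ badHalfEdges (g * τ * g⁻¹) then 1 else 0).symm
      _ ≤ _ := by
        refine Finset.sum_le_sum fun p _ => ?_
        split_ifs with h1 h2
        · omega
        · rw [mem_badHalfEdges] at h1
          have hinv : g⁻¹ (g p) = p := by simp
          simp only [Equiv.Perm.mul_apply, hinv] at h1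
          rcases h1 with h1 | ⟨y, hy, hy1, hy2⟩
          · exact absurd h1 h2
          · rw [zero_add]
            have hyq : y = g (g⁻¹ y) := by simp
            set q := g⁻¹ y with hq
            rw [hyq] at hy hy1
            have hmem : q ∈ Finset.univ.filter (fun q => q ≠ p ∧ q ≠ τ p) := by
              simp only [Finset.mem_filter, Finset.mem_univ, true_and]
              -- If `q = τ p`, then `p` and `τ p` are sent to the same vertex, which is the loop
              -- case already excluded.
              refine ⟨fun h => hy (by rw [h]), fun h => h2 ?_⟩
              rw [← h, hy1]
            refine le_trans ?_ (Finset.single_le_sum (f := fun q =>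
              if (g q).1 = (g p).1 ∧ (g (τ q)).1 = (g (τ p)).1 then 1 else 0)
              (fun _ _ => Nat.zero_le _) hmem)
            simp [hy1, hy2]
        · exact Nat.zero_le _
        · exact Nat.zero_le _
  set M := Fintype.card (V × D) with hMdef
  have hpos : 0 < M := by omega
  have hcardX : (Finset.univ : Finset (V × D)).card = M := Finset.card_univ
  have hloop : ∑ g : Equiv.Perm (V × D), (∑ p, if (g (τ p)).1 = (g p).1 then 1 else 0) ≤
      2 * Fintype.card D * M.factorial := by
    rw [Finset.sum_comm]
    refine Nat.le_of_mul_le_mul_right (c := M) ?_ hpos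
    rw [Finset.sum_mul]
    calc _ ≤ ∑ p : V × D, 2 * Fintype.card D * M.factorial := by
          refine Finset.sum_le_sum fun p _ => ?_
          rw [← Finset.card_filter]
          exact card_filter_loop_mul_le hM (hτ.2 p).symm
      _ = _ := by rw [Finset.sum_const, hcardX, smul_eq_mul, mul_comm]
  have hpar : ∑ g : Equiv.Perm (V × D), (∑ p, ∑ q ∈ Finset.univ.filter
        (fun q => q ≠ p ∧ q ≠ τ p),
        if (g q).1 = (g p).1 ∧ (g (τ q)).1 = (g (τ p)).1 then 1 else 0) ≤
      8 * Fintype.card D ^ 2 * M.factorial := by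
    rw [Finset.sum_comm]
    refine Nat.le_of_mul_le_mul_right (c := M ^ 2) ?_ (by positivity)
    rw [Finset.sum_mul]
    calc _ ≤ ∑ p : V × D, M * (8 * Fintype.card D ^ 2 * M.factorial) := by
          refine Finset.sum_le_sum fun p _ => ?_
          rw [Finset.sum_comm, Finset.sum_mul]
          calc _ ≤ ∑ q ∈ Finset.univ.filter (fun q => q ≠ p ∧ q ≠ τ p),
                8 * Fintype.card D ^ 2 * M.factorial := by
                refine Finset.sum_le_sum fun q hq => ?_
                simp only [Finset.mem_filter, Finset.mem_univ, true_and] at hq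
                rw [← Finset.card_filter]
                refine card_filter_parallel_mul_le hM (hτ.2 p).symm hq.1.symm ?_ hq.2.symm ?_
                  (hτ.2 q).symm
                · intro h; exact hq.2 (by rw [h, hτ.1])
                · intro h; exact hq.1 (τ.injective h).symm
            _ ≤ _ := by
                rw [Finset.sum_const, smul_eq_mul]
                exact Nat.mul_le_mul_right _ ((Finset.card_filter_le _ _).trans hcardX.le)
      _ = _ := by rw [Finset.sum_const, hcardX, smul_eq_mul]; ring
  calc _ ≤ _ := Finset.sum_le_sum fun g _ => hpt g
    _ ≤ 2 * Fintype.card D * M.factorial + 8 * Fintype.card D ^ 2 * M.factorial := by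
      rw [Finset.sum_add_distrib]; exact Nat.add_le_add hloop hpar
    _ ≤ _ := by
      have : Fintype.card D ≤ Fintype.card D ^ 2 := Nat.le_self_pow (by norm_num) _
      nlinarith [Nat.mul_le_mul_right M.factorial this]

/-- A polynomial fraction of all matchings of the half-edges is simple. -/
theorem factorial_le_card_isSimplePairing {V D : Type*} [Fintype V] [Fintype D]
    {τ : Equiv.Perm (V × D)} (hτ : IsPairing τ) (hM : 6 ≤ Fintype.card (V × D))
    (hM' : 20 * Fintype.card D ^ 2 + 4 * (Fintype.card D + 1) * Fintype.card D <
      Fintype.card (V × D)) :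
    (Fintype.card (V × D)).factorial ≤
      2 * (Fintype.card (V × D) ^ 2) ^ (20 * Fintype.card D ^ 2) *
        Nat.card {g : Equiv.Perm (V × D) // IsSimplePairing (g * τ * g⁻¹)} := by
  classical
  have h1 := sum_card_badHalfEdges_le hτ hM
  have h2 := card_filter_badHalfEdges_le hτ _ hM'
  have hs : Nat.card {g : Equiv.Perm (V × D) // IsSimplePairing (g * τ * g⁻¹)} =
      (Finset.univ.filter fun g : Equiv.Perm (V × D) =>
      (badHalfEdges (g * τ * g⁻¹)).card ≤ 0).card := by
    rw [Nat.card_eq_fintype_card, Fintype.card_subtype]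
    congr 1
    ext g
    simp [isSimplePairing_iff_badHalfEdges_eq_empty]
  rw [hs]
  have h3 := Finset.card_filter_add_card_filter_not (s := Finset.univ)
    (fun g : Equiv.Perm (V × D) => (badHalfEdges (g * τ * g⁻¹)).card ≤ 20 * Fintype.card D ^ 2)
  rw [Finset.card_univ, Fintype.card_perm] at h3
  -- Markov's inequality: the mean is at most 10|D|², so at most half of the permutations have more
  -- than 20|D|² bad half-edges.
  have h4 : (Finset.univ.filter fun g : Equiv.Perm (V × D) =>
      ¬ (badHalfEdges (g * τ * g⁻¹)).card ≤ 20 * Fintype.card D ^ 2).card *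
      (20 * Fintype.card D ^ 2) ≤ 10 * Fintype.card D ^ 2 * (Fintype.card (V × D)).factorial := by
    refine le_trans ?_ h1
    rw [← smul_eq_mul, ← Finset.sum_const]
    refine le_trans (Finset.sum_le_sum fun g hg => ?_)
      (Finset.sum_le_sum_of_subset (Finset.subset_univ _))
    simp only [Finset.mem_filter, Finset.mem_univ, true_and] at hg
    omega
  have hD : 0 < 10 * Fintype.card D ^ 2 := by
    rcases Nat.eq_zero_or_pos (Fintype.card D) with h | h
    · rw [Fintype.card_prod, h] at hM; omega
    · positivity
  have h5 : 2 * (Finset.univ.filter fun g : Equiv.Perm (V × D) =>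
      ¬ (badHalfEdges (g * τ * g⁻¹)).card ≤ 20 * Fintype.card D ^ 2).card ≤
      (Fintype.card (V × D)).factorial := by
    refine Nat.le_of_mul_le_mul_left (c := 10 * Fintype.card D ^ 2) ?_ hD
    linarith
  rw [mul_assoc]
  omega

/-! ### Matchings with no edge between two vertex sets -/

/-- Such permutations, if there are any, form a coset of the stabilizer of `t`, which is a product
of symmetric groups on the fibres of `t`. -/
theorem card_filter_comp_eq_le {X : Type*} [Fintype X] [DecidableEq X] (t s : X → Fin 3) :
    (Finset.univ.filter fun g : Equiv.Perm X => t ∘ g = s).card ≤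
      ∏ i, (Fintype.card {x // t x = i}).factorial := by
  rw [← DomMulAct.stabilizer_card, Fintype.card_subtype]
  rcases (Finset.univ.filter fun g : Equiv.Perm X => t ∘ g = s).eq_empty_or_nonempty with h | ⟨g₀, h₀⟩
  · simp [h]
  · simp only [Finset.mem_filter, Finset.mem_univ, true_and] at h₀
    refine Finset.card_le_card_of_injOn (fun g => g * g₀⁻¹) ?_ ?_
    · intro g hg
      simp only [Finset.coe_filter, Finset.mem_univ, true_and, Set.mem_ofPred_eq] at hg ⊢
      funext x
      have h1 := congrFun (hg.trans h₀.symm) (g₀⁻¹ x)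
      simpa using h1
    · intro g _ g' _ h
      exact mul_right_cancel h

/-- The involution that joins the two halves of each element of `V × κ`. -/
def flipHalf (V κ : Type*) : Equiv.Perm (V × (κ × Bool)) :=
  Equiv.prodCongr (Equiv.refl V) (Equiv.prodCongr (Equiv.refl κ) Equiv.boolNot)

theorem flipHalf_apply {V κ : Type*} (v : V) (j : κ) (b : Bool) :
    flipHalf V κ (v, (j, b)) = (v, (j, !b)) := rfl

theorem isPairing_flipHalf (V κ : Type*) : IsPairing (flipHalf V κ) := by
  constructor
  · rintro ⟨v, j, b⟩; simp [flipHalf_apply]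
  · rintro ⟨v, j, b⟩; simp [flipHalf_apply]

/-- With the sizes of the three classes left free, the constraint concerns each matched pair
separately, so the sum over patterns factorises over the pairs. -/
theorem sum_prod_weight_le {V κ : Type*} [Fintype V] [Fintype κ] [DecidableEq V] [DecidableEq κ]
    (w : Fin 3 → ℝ) (hw : ∀ i, 0 ≤ w i) :
    ∑ s ∈ Finset.univ.filter (fun s : V × (κ × Bool) → Fin 3 =>
      ∀ p, ¬ (s p = 0 ∧ s (flipHalf V κ p) = 1)), ∏ x, w (s x) ≤
    (∑ a ∈ Finset.univ.filter (fun a : Fin 3 × Fin 3 => a ≠ (0, 1) ∧ a ≠ (1, 0)),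
      w a.1 * w a.2) ^ Fintype.card (V × κ) := by
  set A := Finset.univ.filter (fun a : Fin 3 × Fin 3 => a ≠ (0, 1) ∧ a ≠ (1, 0)) with hA
  rw [← Finset.card_univ, ← Finset.prod_const, Finset.prod_univ_sum]
  let φ : (V × (κ × Bool) → Fin 3) → (V × κ → Fin 3 × Fin 3) := fun s u =>
    (s (u.1, (u.2, false)), s (u.1, (u.2, true)))
  have hφ : Function.Injective φ := by
    intro s s' h
    funext ⟨v, j, b⟩
    have := congrFun h (v, j)
    simp only [φ, Prod.mk.injEq] at this
    cases b
    · exact this.1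
    · exact this.2
  have hprod : ∀ s : V × (κ × Bool) → Fin 3,
      ∏ x, w (s x) = ∏ u : V × κ, w (φ s u).1 * w (φ s u).2 := by
    intro s
    rw [Fintype.prod_prod_type, Fintype.prod_prod_type]
    refine Finset.prod_congr rfl fun v _ => ?_
    rw [Fintype.prod_prod_type]
    refine Finset.prod_congr rfl fun j _ => ?_
    rw [Fintype.prod_bool, mul_comm]
  rw [Finset.sum_congr rfl (fun s _ => hprod s),
    ← Finset.sum_image (g := φ) (f := fun r => ∏ u, w (r u).1 * w (r u).2) hφ.injOn]
  refine Finset.sum_le_sum_of_subset_of_nonneg ?_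
    (fun r _ _ => Finset.prod_nonneg fun u _ => mul_nonneg (hw _) (hw _))
  intro r hr
  obtain ⟨s, hs, rfl⟩ := Finset.mem_image.1 hr
  simp only [Finset.mem_filter, Finset.mem_univ, true_and] at hs
  rw [Fintype.mem_piFinset]
  rintro ⟨v, j⟩
  have h1 := hs (v, (j, false))
  have h2 := hs (v, (j, true))
  simp only [flipHalf_apply, Bool.not_false, Bool.not_true] at h1 h2
  simp only [hA, φ, Finset.mem_filter, Finset.mem_univ, true_and, ne_eq, Prod.mk.injEq]
  tauto

/-- A permutation is grouped by its pattern `t ∘ g`, which has the same total weight as `t`.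
Patterns with the wrong class sizes are counted too, but only add nonnegative terms; choosing `w`
well keeps this excess small. -/
theorem card_filter_mul_prod_weight_le {V κ : Type*} [Fintype V] [Fintype κ] [DecidableEq V]
    [DecidableEq κ] (t : V × (κ × Bool) → Fin 3) (w : Fin 3 → ℝ) (hw : ∀ i, 0 ≤ w i) :
    ((Finset.univ.filter fun g : Equiv.Perm (V × (κ × Bool)) =>
      ∀ p, ¬ (t (g p) = 0 ∧ t (g (flipHalf V κ p)) = 1)).card : ℝ) * ∏ x, w (t x) ≤
    ((∏ i, (Fintype.card {x // t x = i}).factorial : ℕ) : ℝ) *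
    (∑ a ∈ Finset.univ.filter (fun a : Fin 3 × Fin 3 => a ≠ (0, 1) ∧ a ≠ (1, 0)),
      w a.1 * w a.2) ^ Fintype.card (V × κ) := by
  refine le_trans ?_ (mul_le_mul_of_nonneg_left (sum_prod_weight_le w hw) (Nat.cast_nonneg _))
  set G := Finset.univ.filter fun g : Equiv.Perm (V × (κ × Bool)) =>
      ∀ p, ¬ (t (g p) = 0 ∧ t (g (flipHalf V κ p)) = 1) with hG
  rw [Finset.card_eq_sum_card_fiberwise (f := fun g : Equiv.Perm (V × (κ × Bool)) => t ∘ g)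
    (t := Finset.univ.filter (fun s : V × (κ × Bool) → Fin 3 =>
      ∀ p, ¬ (s p = 0 ∧ s (flipHalf V κ p) = 1))) (by intro g hg; simpa [hG] using hg)]
  push_cast
  rw [Finset.sum_mul, Finset.mul_sum]
  refine Finset.sum_le_sum fun s hs => ?_
  rcases (G.filter fun g : Equiv.Perm (V × (κ × Bool)) => t ∘ g = s).eq_empty_or_nonempty with h | ⟨g, hg⟩
  · rw [h]
    simp only [Finset.card_empty, Nat.cast_zero, zero_mul]
    exact mul_nonneg (Finset.prod_nonneg fun _ _ => Nat.cast_nonneg _)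
      (Finset.prod_nonneg fun _ _ => hw _)
  · have hg' := (Finset.mem_filter.1 hg).2
    have h1 : ∏ x, w (t x) = ∏ x, w (s x) := by
      rw [← hg']
      exact (Equiv.prod_comp g (fun x => w (t x))).symm
    rw [h1]
    refine mul_le_mul_of_nonneg_right ?_ (Finset.prod_nonneg fun _ _ => hw _)
    have h2 := (Finset.card_le_card (Finset.filter_subset_filter
      (fun g : Equiv.Perm (V × (κ × Bool)) => t ∘ g = s)
      (Finset.subset_univ G))).trans (card_filter_comp_eq_le t s)
    exact_mod_cast h2

open scoped Classical in
/-- The number of matchings of the half-edges with no edge between two given vertex sets. -/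
theorem card_filter_no_edge_between_le {V κ : Type*} [Fintype V] [Fintype κ] {s : ℕ}
    {S T : Finset V} (hS : S.card = s) (hT : T.card = s) (hST : Disjoint S T) {z : ℝ} (hz : 0 ≤ z) :
    ((Finset.univ.filter fun g : Equiv.Perm (V × (κ × Bool)) =>
      ∀ p, ¬ ((g p).1 ∈ S ∧ (g (flipHalf V κ p)).1 ∈ T)).card : ℝ) *
      z ^ ((Fintype.card V - 2 * s) * (2 * Fintype.card κ)) ≤
    ((s * (2 * Fintype.card κ)).factorial : ℝ) ^ 2 *
      (((Fintype.card V - 2 * s) * (2 * Fintype.card κ)).factorial : ℝ) *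
      (z ^ 2 + 4 * z + 2) ^ (Fintype.card V * Fintype.card κ) := by
  let c : V → Fin 3 := fun v => if v ∈ S then 0 else if v ∈ T then 1 else 2
  have hc0 : ∀ v, c v = 0 ↔ v ∈ S := by intro v; simp only [c]; split_ifs <;> simp_all
  have hc1 : ∀ v, c v = 1 ↔ v ∈ T := by
    intro v
    have : v ∈ S → v ∉ T := fun h => Finset.disjoint_left.1 hST h
    simp only [c]; split_ifs <;> simp_all
  have hc2 : ∀ v, c v = 2 ↔ v ∈ (S ∪ T)ᶜ := by
    intro v; simp only [c]; split_ifs <;> simp_all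
  have hfib : ∀ (i : Fin 3) (U : Finset V), (∀ v, c v = i ↔ v ∈ U) →
      Fintype.card {x : V × (κ × Bool) // c x.1 = i} = U.card * (2 * Fintype.card κ) := by
    intro i U hU
    rw [Fintype.card_subtype]
    have : (Finset.univ.filter fun x : V × (κ × Bool) => c x.1 = i) = U ×ˢ Finset.univ := by
      ext x; simp [hU]
    rw [this, Finset.card_product, Finset.card_univ, Fintype.card_prod, Fintype.card_bool,
      mul_comm 2]
  have hR : ((S ∪ T)ᶜ).card = Fintype.card V - 2 * s := by
    rw [Finset.card_compl, Finset.card_union_of_disjoint hST, hS, hT, two_mul]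
  -- Classes 0, 1, 2 are `S`, `T` and the rest, with weights 1, 1, z. Removing the pairs 01 and 10
  -- from (1 + 1 + z)² leaves z² + 4z + 2.
  have h := card_filter_mul_prod_weight_le (fun x : V × (κ × Bool) => c x.1) ![1, 1, z]
    (by intro i; fin_cases i <;> simp [hz])
  have hprod : ∏ x : V × (κ × Bool), (![1, 1, z] : Fin 3 → ℝ) (c x.1) =
      z ^ ((Fintype.card V - 2 * s) * (2 * Fintype.card κ)) := by
    have h1 : ∀ x : V × (κ × Bool), (![1, 1, z] : Fin 3 → ℝ) (c x.1) =
        if c x.1 = 2 then z else 1 := by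
      intro x
      generalize c x.1 = i
      fin_cases i <;> simp
    rw [Finset.prod_congr rfl fun x _ => h1 x, Finset.prod_ite, Finset.prod_const_one, mul_one,
      Finset.prod_const, ← Fintype.card_subtype, hfib 2 _ hc2, hR]
  have hsum : ∑ a ∈ Finset.univ.filter (fun a : Fin 3 × Fin 3 => a ≠ (0, 1) ∧ a ≠ (1, 0)),
      (![1, 1, z] : Fin 3 → ℝ) a.1 * (![1, 1, z] : Fin 3 → ℝ) a.2 = z ^ 2 + 4 * z + 2 := by
    have : (Finset.univ.filter (fun a : Fin 3 × Fin 3 => a ≠ (0, 1) ∧ a ≠ (1, 0))) =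
      {(0, 0), (0, 2), (1, 1), (1, 2), (2, 0), (2, 1), (2, 2)} := by decide
    rw [this]
    simp
    ring
  rw [hprod, hsum, Fintype.card_prod, Fin.prod_univ_three, hfib 0 _ hc0, hfib 1 _ hc1,
    hfib 2 _ hc2, hR, hS, hT] at h
  simp only [hc0, hc1] at h
  push_cast at h
  rw [pow_two ((s * (2 * Fintype.card κ)).factorial : ℝ)]
  convert! h using 2

/-! ### The exponential rate of the first moment -/

/-- The exponential growth rate, per vertex, of the expected number of pairs of disjoint sets of
density `σ` without edges between them in a random 30-regular graph. -/
noncomputable def gapExponent (σ : ℝ) : ℝ :=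
  29 * (2 * (σ * Real.log σ) + (1 - 2 * σ) * Real.log (1 - 2 * σ)) + 15 * Real.log (3049 / 100) -
    30 * (1 - 2 * σ) * Real.log (37 / 10)

/-- The value is only about -1.2 · 10⁻⁴, so each logarithm is needed to roughly six decimals. Powers
of 2 are split off where needed to bring the argument close to 1, and the Taylor series of log(1 -
x) is truncated with its error bound. -/
theorem gapExponent_neg : gapExponent (3219 / 20876) < 0 := by
  have hl1 := Real.log_two_gt_d9
  have hl2 := Real.log_two_lt_d9
  have ha : Real.log (3219 / 20876) ≤ 2099122 / 10000000 - 3 * Real.log 2 := by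
    have h := (abs_le.1 (Real.abs_log_sub_add_sum_range_le (x := -(1219 / 5219)) (by
      rw [abs_neg, abs_of_pos] <;> norm_num) 13)).2
    have e : (3219 / 20876 : ℝ) = (1 - -(1219 / 5219)) / 2 ^ 3 := by norm_num
    rw [e, Real.log_div (by norm_num) (by norm_num), Real.log_pow]
    rw [abs_neg, abs_of_pos (by norm_num)] at h
    norm_num [Finset.sum_range_succ] at h ⊢
    linarith
  have hb : Real.log (14438 / 20876) ≤ -(3687365 / 10000000) := by
    have h := (abs_le.1 (Real.abs_log_sub_add_sum_range_le (x := 6438 / 20876) (by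
      rw [abs_of_pos] <;> norm_num) 15)).2
    rw [abs_of_pos (by norm_num)] at h
    norm_num [Finset.sum_range_succ] at h ⊢
    linarith
  have hQ : Real.log (3049 / 100) ≤ 5 * Real.log 2 - 483371 / 10000000 := by
    have h := (abs_le.1 (Real.abs_log_sub_add_sum_range_le (x := 151 / 3200) (by
      rw [abs_of_pos] <;> norm_num) 7)).2
    have e : (3049 / 100 : ℝ) = (1 - 151 / 3200) * 2 ^ 5 := by norm_num
    rw [e, Real.log_mul (by norm_num) (by norm_num), Real.log_pow]
    rw [abs_of_pos (by norm_num)] at h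
    norm_num [Finset.sum_range_succ] at h ⊢
    linarith
  have hz : 2 * Real.log 2 - 779616 / 10000000 ≤ Real.log (37 / 10) := by
    have h := (abs_le.1 (Real.abs_log_sub_add_sum_range_le (x := 3 / 40) (by
      rw [abs_of_pos] <;> norm_num) 7)).1
    have e : (37 / 10 : ℝ) = (1 - 3 / 40) * 2 ^ 2 := by norm_num
    rw [e, Real.log_mul (by norm_num) (by norm_num), Real.log_pow]
    rw [abs_of_pos (by norm_num)] at h
    norm_num [Finset.sum_range_succ] at h ⊢
    linarith
  have e : gapExponent (3219 / 20876) = 58 * (3219 / 20876) * Real.log (3219 / 20876) +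
    29 * (14438 / 20876) * Real.log (14438 / 20876) + 15 * Real.log (3049 / 100) -
    30 * (14438 / 20876) * Real.log (37 / 10) := by
    rw [gapExponent]; norm_num; ring
  rw [e]
  linarith

theorem continuousAt_gapExponent {σ : ℝ} (h0 : 0 < σ) (h1 : σ < 1 / 2) :
    ContinuousAt gapExponent σ := by
  unfold gapExponent
  have e1 : ContinuousAt (fun σ : ℝ => Real.log (1 - 2 * σ)) σ :=
    ContinuousAt.log (by fun_prop) (by linarith)
  have e2 : ContinuousAt (fun σ : ℝ => Real.log σ) σ := ContinuousAt.log (by fun_prop) h0.ne'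
  fun_prop

theorem log_factorial_ge (n : ℕ) : n * Real.log n - n ≤ Real.log (n.factorial) := by
  rcases Nat.eq_zero_or_pos n with rfl | hn
  · simp
  have hn' : (0 : ℝ) < n := by exact_mod_cast hn
  have h := Real.pow_div_factorial_le_exp n hn'.le n
  have hf : (0 : ℝ) < n.factorial := by exact_mod_cast n.factorial_pos
  have h2 := Real.log_le_log (by positivity) h
  rw [Real.log_exp, Real.log_div (by positivity) hf.ne', Real.log_pow] at h2
  linarith

theorem log_factorial_le (n : ℕ) :
    Real.log (n.factorial) ≤ n * Real.log n - n + Real.log n + 1 := by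
  rcases Nat.eq_zero_or_pos n with rfl | hn
  · simp
  induction n, hn using Nat.le_induction with
  | base => simp
  | succ n hn ih =>
    have hn' : (0 : ℝ) < n := by exact_mod_cast hn
    have hf : (n.factorial : ℝ) ≠ 0 := by exact_mod_cast n.factorial_ne_zero
    rw [Nat.factorial_succ]
    push_cast
    rw [Real.log_mul (by positivity) hf]
    have h := Real.one_sub_inv_le_log_of_pos (x := ((n : ℝ) + 1) / n) (by positivity)
    rw [Real.log_div (by positivity) hn'.ne', inv_div] at h
    have h2 : (n + 1 : ℝ) * (1 - n / (n + 1)) = 1 := by field_simp; ring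
    have h3 := mul_le_mul_of_nonneg_left h (by positivity : (0 : ℝ) ≤ n + 1)
    rw [h2] at h3
    linarith

/-- The bound on the probability that a random 30-regular graph on `N` vertices has two disjoint
sets of `s` vertices with no edge between them. -/
noncomputable def gapBound (N s : ℕ) : ℝ :=
  2 * ((30 * N : ℕ) : ℝ) ^ 36000 *
    ((N.factorial * ((30 * s).factorial ^ 2 * (30 * (N - 2 * s)).factorial) : ℕ) : ℝ) /
    (((30 * N).factorial * (s.factorial ^ 2 * (N - 2 * s).factorial) : ℕ) : ℝ) *
    ((3049 / 100 : ℝ) ^ (15 * N) / (37 / 10 : ℝ) ^ (30 * (N - 2 * s)))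

theorem gapBound_pos {N : ℕ} (hN : 0 < N) (s : ℕ) : 0 < gapBound N s := by
  have h := fun n : ℕ => n.factorial_pos
  have h1 := h N
  have h2 := h s
  have h3 := h (N - 2 * s)
  have h4 := h (30 * N)
  have h5 := h (30 * s)
  have h6 := h (30 * (N - 2 * s))
  unfold gapBound
  positivity

/-- The choice of `S` and `T` contributes the entropy terms once with a minus sign and the half-edge
factorials contribute them 30 times with a plus sign, hence the 29 in `gapExponent`. Linear terms
and multiples of log 30 cancel since 2s + (N - 2s) = N. The 36004 is the exponent 36000 plus one
logarithmic error for each of the four upper factorials, the square counting twice; 10 absorbs log 2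
+ 4. -/
theorem log_gapBound_le {N s : ℕ} (hs : 0 < s) (hN : 2 * s < N) :
    Real.log (gapBound N s) ≤
      N * gapExponent (s / N) + 36004 * Real.log (30 * N) + 10 := by
  obtain ⟨r, rfl⟩ : ∃ r, N = r + 2 * s := ⟨N - 2 * s, by omega⟩
  have hr : 0 < r := by omega
  have er : r + 2 * s - 2 * s = r := by omega
  rw [gapBound, er]
  set N := r + 2 * s with hNdef
  have hN0 : 0 < N := by omega
  have hf := fun n : ℕ => (show (0 : ℝ) < n.factorial by exact_mod_cast n.factorial_pos)
  have hf' := fun n : ℕ => (hf n).ne'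
  have hsR : (0 : ℝ) < s := by exact_mod_cast hs
  have hrR : (0 : ℝ) < r := by exact_mod_cast hr
  have hNR : (0 : ℝ) < N := by exact_mod_cast hN0
  have hNeq : (N : ℝ) = r + 2 * s := by rw [hNdef]; push_cast; ring
  push_cast
  rw [Real.log_mul (by have := hf; simp [hf', hNR.ne']) (by positivity),
    Real.log_div (by simp [hf', hNR.ne']) (by simp [hf']),
    Real.log_mul (by positivity) (by simp [hf']), Real.log_mul (by norm_num) (by positivity),
    Real.log_mul (hf' _) (by simp [hf']), Real.log_mul (by simp [hf']) (hf' _),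
    Real.log_mul (hf' _) (by simp [hf']), Real.log_mul (by simp [hf']) (hf' _),
    Real.log_div (by positivity) (by positivity), Real.log_pow, Real.log_pow, Real.log_pow,
    Real.log_pow, Real.log_pow]
  have u1 := log_factorial_le N
  have u2 := log_factorial_le (30 * s)
  have u3 := log_factorial_le (30 * r)
  have l1 := log_factorial_ge s
  have l2 := log_factorial_ge r
  have l3 := log_factorial_ge (30 * N)
  push_cast at u1 u2 u3 l1 l2 l3 ⊢
  have hmono : ∀ x : ℝ, 0 < x → x ≤ 30 * N → Real.log x ≤ Real.log (30 * N) :=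
    fun x hx hx' => Real.log_le_log hx hx'
  have m1 := hmono N hNR (by linarith)
  have m2 := hmono (30 * s) (by positivity) (by linarith)
  have m3 := hmono (30 * r) (by positivity) (by linarith)
  have hl2 := Real.log_two_lt_d9
  have e1 : Real.log (30 * s) = Real.log 30 + Real.log s := Real.log_mul (by norm_num) hsR.ne'
  have e2 : Real.log (30 * r) = Real.log 30 + Real.log r := Real.log_mul (by norm_num) hrR.ne'
  have e3 : Real.log (30 * N) = Real.log 30 + Real.log N := Real.log_mul (by norm_num) hNR.ne'
  have hσ : (1 : ℝ) - 2 * (s / N) = r / N := by field_simp; linarith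
  have hE : N * gapExponent (s / N) =
      29 * (2 * (s * Real.log s) + r * Real.log r - N * Real.log N) +
      15 * N * Real.log (3049 / 100) - 30 * r * Real.log (37 / 10) := by
    rw [gapExponent, hσ, Real.log_div hsR.ne' hNR.ne', Real.log_div hrR.ne' hNR.ne']
    have : (N : ℝ) * Real.log N = (r + 2 * s) * Real.log N := by rw [← hNeq]
    rw [this]
    field_simp
    ring
  rw [hE]
  have k2 : 30 * (s : ℝ) * Real.log (30 * s) = 30 * (s * Real.log 30) + 30 * (s * Real.log s) := by
    rw [e1]; ring
  have k3 : 30 * (r : ℝ) * Real.log (30 * r) = 30 * (r * Real.log 30) + 30 * (r * Real.log r) := by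
    rw [e2]; ring
  have k4 : 30 * (N : ℝ) * Real.log (30 * N) = 30 * (r * Real.log 30) + 60 * (s * Real.log 30) +
      30 * (N * Real.log N) := by
    rw [e3, mul_add]
    nth_rewrite 1 [hNeq]
    ring
  rw [k2] at u2
  rw [k3] at u3
  rw [k4] at l3
  linarith

theorem tendsto_gapBound {N s : ℕ → ℕ} (hN : Tendsto N atTop atTop)
    (hs : Tendsto (fun n => (s n : ℝ) / N n) atTop (𝓝 (3219 / 20876))) :
    Tendsto (fun n => gapBound (N n) (s n)) atTop (𝓝 0) := by
  have hE : Tendsto (fun n => gapExponent (s n / N n)) atTop (𝓝 (gapExponent (3219 / 20876))) :=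
    (continuousAt_gapExponent (by norm_num) (by norm_num)).tendsto.comp hs
  -- Half of the negative exponent is kept as slack for s/N being only asymptotically equal to
  -- 3219/20876.
  set δ := -gapExponent (3219 / 20876) / 2 with hδ
  have hδ0 : 0 < δ := by have := gapExponent_neg; rw [hδ]; linarith
  have hE' : ∀ᶠ n in atTop, gapExponent (s n / N n) < -δ :=
    hE.eventually_lt_const (by rw [hδ]; have := gapExponent_neg; linarith)
  have hs0 : ∀ᶠ n in atTop, (1 / 10 : ℝ) < s n / N n := hs.eventually_const_lt (by norm_num)
  have hs1 : ∀ᶠ n in atTop, (s n : ℝ) / N n < 1 / 5 := hs.eventually_lt_const (by norm_num)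
  have hNR : Tendsto (fun n => (N n : ℝ)) atTop atTop := tendsto_natCast_atTop_atTop.comp hN
  have hlog : Tendsto (fun x : ℝ => -δ * x + 36004 * Real.log (30 * x) + 10) atTop atBot := by
    have h1 : Tendsto (fun x : ℝ => Real.log x / x) atTop (𝓝 0) := by
      simpa using (Real.isLittleO_log_id_atTop.tendsto_div_nhds_zero)
    have h2 : Tendsto (fun x : ℝ => -δ + 36004 * (Real.log x / x)) atTop (𝓝 (-δ + 36004 * 0)) :=
      (h1.const_mul _).const_add _
    have h3 : Tendsto (fun x : ℝ => (-δ + 36004 * (Real.log x / x)) * x) atTop atBot :=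
      h2.neg_mul_atTop (by linarith) tendsto_id
    have h4 : Tendsto (fun x : ℝ => (-δ + 36004 * (Real.log x / x)) * x +
      (36004 * Real.log 30 + 10)) atTop atBot := tendsto_atBot_add_const_right _ _ h3
    refine h4.congr' ?_
    filter_upwards [eventually_gt_atTop 0] with x hx
    rw [Real.log_mul (by norm_num) hx.ne']
    field_simp
    ring
  have hup : Tendsto (fun n => Real.exp (-δ * N n + 36004 * Real.log (30 * N n) + 10)) atTop
      (𝓝 0) := Real.tendsto_exp_atBot.comp (hlog.comp hNR)
  refine tendsto_of_tendsto_of_tendsto_of_le_of_le' tendsto_const_nhds hup ?_ ?_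
  · filter_upwards [hN.eventually_gt_atTop 0] with n hn using (gapBound_pos hn _).le
  · filter_upwards [hN.eventually_gt_atTop 0, hE', hs0, hs1] with n hn h1 h2 h3
    have hnR : (0 : ℝ) < N n := by exact_mod_cast hn
    rw [lt_div_iff₀ hnR] at h2
    rw [div_lt_iff₀ hnR] at h3
    have h4 : 0 < s n := by
      have : (0 : ℝ) < s n := by linarith
      exact_mod_cast this
    have h5 : 2 * s n < N n := by
      have : (2 : ℝ) * s n < N n := by linarith
      exact_mod_cast this
    rw [← Real.exp_log (gapBound_pos hn (s n))]
    refine Real.exp_le_exp.2 ((log_gapBound_le h4 h5).trans ?_)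
    have := mul_le_mul_of_nonneg_left h1.le hnR.le
    linarith

/-! ### Union bound and transfer to regular graphs -/

theorem card_disjoint_pairs_mul {V : Type*} [Fintype V] [DecidableEq V] (s : ℕ)
    (hs : 2 * s ≤ Fintype.card V) :
    (Finset.univ.filter fun p : Finset V × Finset V =>
      p.1.card = s ∧ p.2.card = s ∧ Disjoint p.1 p.2).card *
      (s.factorial ^ 2 * (Fintype.card V - 2 * s).factorial) = (Fintype.card V).factorial := by
  have h1 : (Finset.univ.filter fun p : Finset V × Finset V =>
      p.1.card = s ∧ p.2.card = s ∧ Disjoint p.1 p.2).card =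
      (Fintype.card V).choose s * (Fintype.card V - s).choose s := by
    rw [Finset.card_eq_sum_card_fiberwise (f := Prod.fst) (t := Finset.univ.powersetCard s)
      (by
        intro p hp
        simp only [Finset.coe_filter, Finset.mem_univ, true_and, Set.mem_ofPred_eq] at hp
        simp [Finset.mem_powersetCard, hp.1]),
      ← Finset.card_univ, ← Finset.card_powersetCard, ← smul_eq_mul, ← Finset.sum_const]
    refine Finset.sum_congr rfl fun S hS => ?_
    have hSc : S.card = s := (Finset.mem_powersetCard.1 hS).2
    rw [← hSc, Finset.card_univ, ← Finset.card_compl, ← Finset.card_powersetCard]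
    refine Finset.card_bij (fun p _ => p.2) ?_ ?_ ?_
    · intro p hp
      simp only [Finset.mem_filter, Finset.mem_univ, true_and] at hp
      rw [Finset.mem_powersetCard]
      refine ⟨?_, hp.1.2.1⟩
      rw [← hp.2]
      exact Finset.subset_compl_iff_disjoint_left.2 hp.1.2.2
    · intro p hp q hq h
      exact Prod.ext ((Finset.mem_filter.1 hp).2.trans (Finset.mem_filter.1 hq).2.symm) h
    · intro T hT
      rw [Finset.mem_powersetCard] at hT
      refine ⟨(S, T), ?_, rfl⟩
      simp only [Finset.mem_filter, Finset.mem_univ, true_and, and_true]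
      exact ⟨hT.2, Finset.subset_compl_iff_disjoint_left.1 hT.1⟩
  rw [h1]
  have h2 := Nat.choose_mul_factorial_mul_factorial (show s ≤ Fintype.card V by omega)
  have h3 := Nat.choose_mul_factorial_mul_factorial (show s ≤ Fintype.card V - s by omega)
  have h4 : Fintype.card V - s - s = Fintype.card V - 2 * s := by omega
  rw [h4] at h3
  rw [← h2, ← h3]
  ring

/-- The union bound over all pairs of disjoint vertex sets of a given size. -/
theorem card_exists_no_edge_between_le {V κ : Type*} [Fintype V] [Fintype κ] {s : ℕ}
    (hs : 2 * s ≤ Fintype.card V) {z : ℝ} (hz : 0 ≤ z) :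
    (Nat.card {g : Equiv.Perm (V × (κ × Bool)) // ∃ S T : Finset V, S.card = s ∧ T.card = s ∧
      Disjoint S T ∧ ∀ p, ¬ ((g p).1 ∈ S ∧ (g (flipHalf V κ p)).1 ∈ T)} : ℝ) *
      (z ^ ((Fintype.card V - 2 * s) * (2 * Fintype.card κ)) *
        (s.factorial ^ 2 * (Fintype.card V - 2 * s).factorial)) ≤
    (Fintype.card V).factorial * (((s * (2 * Fintype.card κ)).factorial : ℝ) ^ 2 *
      (((Fintype.card V - 2 * s) * (2 * Fintype.card κ)).factorial : ℝ) *
      (z ^ 2 + 4 * z + 2) ^ (Fintype.card V * Fintype.card κ)) := by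
  classical
  have hpairs := card_disjoint_pairs_mul (V := V) s hs
  set A := Finset.univ.filter fun p : Finset V × Finset V =>
      p.1.card = s ∧ p.2.card = s ∧ Disjoint p.1 p.2
  let f : Finset V × Finset V → Finset (Equiv.Perm (V × (κ × Bool))) := fun p =>
    Finset.univ.filter fun g : Equiv.Perm (V × (κ × Bool)) =>
      ∀ x, ¬ ((g x).1 ∈ p.1 ∧ (g (flipHalf V κ x)).1 ∈ p.2)
  have hcard : Nat.card {g : Equiv.Perm (V × (κ × Bool)) // ∃ S T : Finset V, S.card = s ∧
      T.card = s ∧ Disjoint S T ∧ ∀ p, ¬ ((g p).1 ∈ S ∧ (g (flipHalf V κ p)).1 ∈ T)} ≤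
      ∑ p ∈ A, (f p).card := by
    rw [Nat.card_eq_fintype_card, Fintype.card_subtype]
    refine le_trans (Finset.card_le_card ?_) Finset.card_biUnion_le
    intro g hg
    obtain ⟨S, T, hS, hT, hST, hno⟩ := (Finset.mem_filter.1 hg).2
    exact Finset.mem_biUnion.2 ⟨(S, T), Finset.mem_filter.2 ⟨Finset.mem_univ _, hS, hT, hST⟩,
      Finset.mem_filter.2 ⟨Finset.mem_univ _, hno⟩⟩
  have hsum : ((∑ p ∈ A, (f p).card : ℕ) : ℝ) *
      z ^ ((Fintype.card V - 2 * s) * (2 * Fintype.card κ)) ≤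
      A.card * (((s * (2 * Fintype.card κ)).factorial : ℝ) ^ 2 *
      (((Fintype.card V - 2 * s) * (2 * Fintype.card κ)).factorial : ℝ) *
      (z ^ 2 + 4 * z + 2) ^ (Fintype.card V * Fintype.card κ)) := by
    rw [← nsmul_eq_mul A.card, ← Finset.sum_const, Nat.cast_sum, Finset.sum_mul]
    refine Finset.sum_le_sum fun p hp => ?_
    obtain ⟨hS, hT, hST⟩ := (Finset.mem_filter.1 hp).2
    have h := card_filter_no_edge_between_le (κ := κ) hS hT hST hz
    convert! h using 4
  have hpairs' : (A.card : ℝ) * (s.factorial ^ 2 * (Fintype.card V - 2 * s).factorial) =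
      (Fintype.card V).factorial := by exact_mod_cast hpairs
  rw [← hpairs', ← mul_assoc]
  refine (mul_le_mul_of_nonneg_right ((mul_le_mul_of_nonneg_right (Nat.cast_le.2 hcard)
    (pow_nonneg hz _)).trans hsum) (by positivity)).trans (le_of_eq (by ring))

/-- The number of regular graphs with a property, compared with the number of all regular graphs,
when the property forces two disjoint sets of `s` vertices without edges between them. -/
theorem card_regular_mul_le {V κ : Type*} [Fintype V] [Fintype κ] {s : ℕ}
    (hs : 2 * s ≤ Fintype.card V) {z : ℝ} (hz : 0 < z)
    (hM : 6 ≤ Fintype.card (V × (κ × Bool)))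
    (hM' : 20 * Fintype.card (κ × Bool) ^ 2 +
      4 * (Fintype.card (κ × Bool) + 1) * Fintype.card (κ × Bool) <
      Fintype.card (V × (κ × Bool))) (P : SimpleGraph V → Prop)
    (hP : ∀ G, P G → ∃ S T : Finset V, S.card = s ∧ T.card = s ∧ Disjoint S T ∧
      ∀ x ∈ S, ∀ y ∈ T, ¬ G.Adj x y) :
    0 < Nat.card {G : SimpleGraph V // ∀ v, Nat.card (G.neighborSet v) = Nat.card (κ × Bool)} ∧
    (Nat.card {G : SimpleGraph V //
      (∀ v, Nat.card (G.neighborSet v) = Nat.card (κ × Bool)) ∧ P G} : ℝ) ≤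
    Nat.card {G : SimpleGraph V // ∀ v, Nat.card (G.neighborSet v) = Nat.card (κ × Bool)} *
      (2 * (Fintype.card (V × (κ × Bool)) ^ 2) ^ (20 * Fintype.card (κ × Bool) ^ 2) *
        ((Fintype.card V).factorial * (((s * (2 * Fintype.card κ)).factorial : ℝ) ^ 2 *
        (((Fintype.card V - 2 * s) * (2 * Fintype.card κ)).factorial : ℝ))) /
        ((Fintype.card (V × (κ × Bool))).factorial *
          (s.factorial ^ 2 * (Fintype.card V - 2 * s).factorial)) *
        ((z ^ 2 + 4 * z + 2) ^ (Fintype.card V * Fintype.card κ) /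
          z ^ ((Fintype.card V - 2 * s) * (2 * Fintype.card κ)))) := by
  classical
  have hτ := isPairing_flipHalf V κ
  have hlow := factorial_le_card_isSimplePairing hτ hM hM'
  have h1 := card_perm_simple_eq hτ (fun _ => True)
  have h2 := card_perm_simple_eq hτ P
  simp only [and_true] at h1
  have hup : Nat.card {g : Equiv.Perm (V × (κ × Bool)) //
      IsSimplePairing (g * flipHalf V κ * g⁻¹) ∧ P (pairingGraph (g * flipHalf V κ * g⁻¹))} ≤
      Nat.card {g : Equiv.Perm (V × (κ × Bool)) // ∃ S T : Finset V, S.card = s ∧ T.card = s ∧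
      Disjoint S T ∧ ∀ p, ¬ ((g p).1 ∈ S ∧ (g (flipHalf V κ p)).1 ∈ T)} := by
    refine Nat.card_le_card_of_injective (Subtype.map id ?_) (Subtype.map_injective _
      Function.injective_id)
    rintro g ⟨hg, hg'⟩
    obtain ⟨S, T, hS, hT, hST, hno⟩ := hP _ hg'
    refine ⟨S, T, hS, hT, hST, ?_⟩
    rintro x ⟨hx, hx'⟩
    refine hno _ hx _ hx' ((pairingGraph_adj (isPairing_conj hτ g) hg _ _).2 ⟨(g x).2, ?_⟩)
    simp
  have hE := card_exists_no_edge_between_le (κ := κ) hs hz.le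
  rw [h2] at hup
  rw [h1] at hlow
  -- `C` is the number of permutations producing a given regular graph. It is the same for all
  -- graphs, so it cancels in the ratio.
  generalize (Nat.card (κ × Bool)).factorial ^ Nat.card V * Nat.card {g : Equiv.Perm
    (V × (κ × Bool)) // g * flipHalf V κ * g⁻¹ = flipHalf V κ} = C at hup hlow
  generalize Nat.card {G : SimpleGraph V //
    ∀ v, Nat.card (G.neighborSet v) = Nat.card (κ × Bool)} = R at hlow ⊢
  generalize Nat.card {G : SimpleGraph V //
    (∀ v, Nat.card (G.neighborSet v) = Nat.card (κ × Bool)) ∧ P G} = B at hup ⊢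
  generalize Nat.card {g : Equiv.Perm (V × (κ × Bool)) // ∃ S T : Finset V, S.card = s ∧
    T.card = s ∧ Disjoint S T ∧ ∀ p, ¬ ((g p).1 ∈ S ∧ (g (flipHalf V κ p)).1 ∈ T)} = E at hup hE
  have hMpos : (0 : ℝ) < (Fintype.card (V × (κ × Bool))).factorial := by
    exact_mod_cast Nat.factorial_pos _
  have hlow' : ((Fintype.card (V × (κ × Bool))).factorial : ℝ) ≤
      2 * (Fintype.card (V × (κ × Bool)) ^ 2) ^ (20 * Fintype.card (κ × Bool) ^ 2) * (R * C) := by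
    exact_mod_cast hlow
  -- The lower bound for simple pairings also proves that a regular graph exists.
  have hRC : 0 < R * C := by
    rcases Nat.eq_zero_or_pos (R * C) with h | h
    · rw [h, mul_zero] at hlow
      exact absurd hlow (Nat.factorial_pos _).not_ge
    · exact h
  refine ⟨Nat.pos_of_mul_pos_right hRC, ?_⟩
  have hCR : (0 : ℝ) < C := by exact_mod_cast Nat.pos_of_mul_pos_left hRC
  have hup' : (B : ℝ) * C ≤ E := by exact_mod_cast hup
  have hF : (0 : ℝ) < s.factorial ^ 2 * (Fintype.card V - 2 * s).factorial := by
    have h3 : (0 : ℝ) < s.factorial := by exact_mod_cast s.factorial_pos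
    have h4 : (0 : ℝ) < (Fintype.card V - 2 * s).factorial := by
      exact_mod_cast Nat.factorial_pos _
    positivity
  have hZ : 0 < z ^ ((Fintype.card V - 2 * s) * (2 * Fintype.card κ)) := by positivity
  have hW : 0 ≤ ((Fintype.card V).factorial : ℝ) * (((s * (2 * Fintype.card κ)).factorial : ℝ) ^ 2 *
      (((Fintype.card V - 2 * s) * (2 * Fintype.card κ)).factorial : ℝ) *
      (z ^ 2 + 4 * z + 2) ^ (Fintype.card V * Fintype.card κ)) := by positivity
  generalize ((Fintype.card V).factorial : ℝ) = Vf at *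
  generalize ((s * (2 * Fintype.card κ)).factorial : ℝ) ^ 2 *
      (((Fintype.card V - 2 * s) * (2 * Fintype.card κ)).factorial : ℝ) = H at *
  generalize (z ^ 2 + 4 * z + 2) ^ (Fintype.card V * Fintype.card κ) = Q at *
  generalize z ^ ((Fintype.card V - 2 * s) * (2 * Fintype.card κ)) = Z at *
  generalize (s.factorial : ℝ) ^ 2 * ((Fintype.card V - 2 * s).factorial : ℝ) = F at *
  generalize ((Fintype.card (V × (κ × Bool))).factorial : ℝ) = Mf at *
  generalize ((Fintype.card (V × (κ × Bool)) : ℝ) ^ 2) ^ (20 * Fintype.card (κ × Bool) ^ 2) = L at *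
  refine le_of_mul_le_mul_right (a := C * (Z * F) * Mf) ?_ (by positivity)
  calc (B : ℝ) * (C * (Z * F) * Mf) = (B * C) * (Z * F) * Mf := by ring
    _ ≤ E * (Z * F) * Mf := by gcongr
    _ ≤ (Vf * (H * Q)) * (2 * L * (R * C)) := by gcongr
    _ = _ := by field_simp

/-- The failure probability of the arrow relation in the random 30-regular graph. -/
theorem card_regular_not_arrows_le {N n s : ℕ} (hN : 725 ≤ N) (hn : 0 < n)
    (hs : 4 * s + 2 * n ≤ N + 2) :
    0 < Nat.card {G : SimpleGraph (Fin N) // ∀ v, Nat.card (G.neighborSet v) = 30} ∧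
    (Nat.card {G : SimpleGraph (Fin N) // (∀ v, Nat.card (G.neighborSet v) = 30) ∧
      ¬ Arrows G (SimpleGraph.pathGraph n) 2} : ℝ) ≤
    Nat.card {G : SimpleGraph (Fin N) // ∀ v, Nat.card (G.neighborSet v) = 30} *
      gapBound N s := by
  have hD : Fintype.card (Fin 15 × Bool) = 30 := by
    simp only [Fintype.card_prod, Fintype.card_fin, Fintype.card_bool]
  have hD' : Nat.card (Fin 15 × Bool) = 30 := by rw [Nat.card_eq_fintype_card, hD]
  have hM : Fintype.card (Fin N × (Fin 15 × Bool)) = 30 * N := by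
    rw [Fintype.card_prod, hD, Fintype.card_fin, mul_comm]
  -- `z = 37 / 10` nearly minimises (z² + 4z + 2)¹⁵ / z^(30(1 - 2σ)) at the limiting density σ. The
  -- size condition is 20 · 30² + 4 · 31 · 30 = 21720 < 30N, that is, N ≥ 725; the polynomial factor
  -- has exponent 2 · 20 · 30² = 36000.
  have h := card_regular_mul_le (V := Fin N) (κ := Fin 15) (s := s)
    (by rw [Fintype.card_fin]; omega) (z := 37 / 10) (by norm_num) (by rw [hM]; omega)
    (by rw [hM, hD]; omega) (fun G => ¬ Arrows G (SimpleGraph.pathGraph n) 2)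
    (fun G hG => exists_disjoint_not_adj_of_not_arrows hs G hG)
  have e1 : (N - 2 * s) * (2 * 15) = 30 * (N - 2 * s) := by ring
  have e2 : s * (2 * 15) = 30 * s := by ring
  have e3 : ((37 / 10 : ℝ) ^ 2 + 4 * (37 / 10) + 2) = 3049 / 100 := by norm_num
  rw [hM, hD', hD, Fintype.card_fin, Fintype.card_fin, e1, e2, e3,
    mul_comm N 15, ← pow_mul] at h
  rw [gapBound]
  push_cast at h ⊢
  exact h

theorem isRegularOfDegree_iff_card_neighborSet {V : Type*} (G : SimpleGraph V) [G.LocallyFinite]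
    (d : ℕ) : G.IsRegularOfDegree d ↔ ∀ v, Nat.card (G.neighborSet v) = d := by
  simp [SimpleGraph.IsRegularOfDegree, ← SimpleGraph.card_neighborSet_eq_degree,
    Nat.card_eq_fintype_card]

theorem randomRegularGraph_arrows_ge {N n s : ℕ} (hN : 725 ≤ N) (hn : 0 < n)
    (hs : 4 * s + 2 * n ≤ N + 2) :
    1 - ENNReal.ofReal (gapBound N s) ≤
      randomRegularGraph N 30 {G | Arrows G (SimpleGraph.pathGraph n) 2} ∧
    randomRegularGraph N 30 {G | Arrows G (SimpleGraph.pathGraph n) 2} ≤ 1 := by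
  classical
  obtain ⟨hR, hB⟩ := card_regular_not_arrows_le hN hn hs
  set Reg : Finset (SimpleGraph (Fin N)) :=
    Finset.univ.filter fun G => ∀ v, Nat.card (G.neighborSet v) = 30 with hReg
  set Bad : Finset (SimpleGraph (Fin N)) :=
    Finset.univ.filter fun G => ¬ Arrows G (SimpleGraph.pathGraph n) 2 with hBad
  have hm : randomRegularGraph N 30 = uniformOn (Reg : Set (SimpleGraph (Fin N))) := by
    rw [randomRegularGraph]
    congr 1
    ext G
    simp only [hReg, Finset.coe_filter, Finset.mem_univ, true_and, Set.mem_ofPred_eq]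
    exact isRegularOfDegree_iff_card_neighborSet G 30
  have hcR : Nat.card {G : SimpleGraph (Fin N) // ∀ v, Nat.card (G.neighborSet v) = 30} =
      Reg.card := by
    rw [Nat.card_eq_fintype_card, Fintype.card_subtype]
  have hcB : Nat.card {G : SimpleGraph (Fin N) // (∀ v, Nat.card (G.neighborSet v) = 30) ∧
      ¬ Arrows G (SimpleGraph.pathGraph n) 2} = (Reg ∩ Bad).card := by
    rw [Nat.card_eq_fintype_card, Fintype.card_subtype, hReg, hBad, Finset.filter_and]
  rw [hcR] at hR
  rw [hcR, hcB] at hB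
  have hne : (Reg : Set (SimpleGraph (Fin N))).Nonempty := by
    exact_mod_cast Finset.card_pos.1 hR
  have hprob := isProbabilityMeasure_uniformOn Reg.finite_toSet hne
  have hcompl : ({G | Arrows G (SimpleGraph.pathGraph n) 2}ᶜ : Set (SimpleGraph (Fin N))) =
      (Bad : Set (SimpleGraph (Fin N))) := by
    ext G; simp [hBad]
  have hadd := uniformOn_compl {G | Arrows G (SimpleGraph.pathGraph n) 2} Reg.finite_toSet hne
  rw [hcompl, uniformOn_apply_finset] at hadd
  rw [hm]
  refine ⟨?_, prob_le_one⟩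
  rw [tsub_le_iff_right, ← hadd]
  gcongr
  have hRR : (0 : ℝ) < Reg.card := by exact_mod_cast hR
  rw [← ENNReal.ofReal_natCast, ← ENNReal.ofReal_natCast, ← ENNReal.ofReal_div_of_pos hRR]
  apply ENNReal.ofReal_le_ofReal
  rw [div_le_iff₀ hRR]
  linarith

/-! ### Passing to the limit and the size-Ramsey number -/

theorem abs_sub_le_one_of_eq_floor_or_ceil {x : ℝ} (hx : 0 ≤ x) {m : ℕ}
    (hm : m = ⌊x⌋₊ ∨ m = ⌈x⌉₊) : x - 1 ≤ m ∧ (m : ℝ) ≤ x + 1 := by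
  rcases hm with rfl | rfl
  · have := Nat.lt_floor_add_one x
    have := Nat.floor_le hx
    constructor <;> linarith
  · have := Nat.le_ceil x
    have := Nat.ceil_lt_add_one hx
    constructor <;> linarith

theorem tendsto_div_of_abs_sub_le {u : ℕ → ℝ} {a b : ℝ}
    (h : ∀ᶠ n : ℕ in atTop, a * n - b ≤ u n ∧ u n ≤ a * n + b) :
    Tendsto (fun n : ℕ => u n / n) atTop (𝓝 a) := by
  have h0 : Tendsto (fun n : ℕ => b / (n : ℝ)) atTop (𝓝 0) := tendsto_const_div_atTop_nhds_zero_nat b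
  have h1 : Tendsto (fun n : ℕ => a - b / (n : ℝ)) atTop (𝓝 a) := by simpa using h0.const_sub a
  have h2 : Tendsto (fun n : ℕ => a + b / (n : ℝ)) atTop (𝓝 a) := by simpa using h0.const_add a
  refine tendsto_of_tendsto_of_tendsto_of_le_of_le' h1 h2 ?_ ?_
  · filter_upwards [h, eventually_gt_atTop 0] with n hn hn0
    have : (0 : ℝ) < n := by exact_mod_cast hn0
    rw [le_div_iff₀ this, sub_mul, div_mul_cancel₀ _ this.ne']
    exact hn.1
  · filter_upwards [h, eventually_gt_atTop 0] with n hn hn0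
    have : (0 : ℝ) < n := by exact_mod_cast hn0
    rw [div_le_iff₀ this, add_mul, div_mul_cancel₀ _ this.ne']
    exact hn.2

theorem tendsto_randomRegularGraph_arrows (N : ℕ → ℕ)
    (hN : ∀ n : ℕ, N n = ⌊(5.219 : ℝ) * (n : ℝ)⌋₊ ∨ N n = ⌈(5.219 : ℝ) * (n : ℝ)⌉₊) :
    Tendsto
      (fun n : ℕ => randomRegularGraph (N n) 30
        {G : SimpleGraph (Fin (N n)) | Arrows G (SimpleGraph.pathGraph n) 2})
      atTop (𝓝 1) := by
  have hNb : ∀ n, (5.219 : ℝ) * n - 1 ≤ N n ∧ (N n : ℝ) ≤ 5.219 * n + 1 := fun n =>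
    abs_sub_le_one_of_eq_floor_or_ceil (by positivity) (hN n)
  have hNn : Tendsto (fun n : ℕ => (N n : ℝ) / n) atTop (𝓝 5.219) :=
    tendsto_div_of_abs_sub_le (b := 1) (Eventually.of_forall hNb)
  have hge : ∀ᶠ n : ℕ in atTop, 5 * n ≤ N n := by
    filter_upwards [eventually_ge_atTop 5] with n hn
    have hn' : (5 : ℝ) ≤ n := by exact_mod_cast hn
    have : (5 : ℝ) * n ≤ N n := by have := (hNb n).1; norm_num at this ⊢; linarith
    exact_mod_cast this
  have hNtop : Tendsto N atTop atTop := by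
    refine tendsto_atTop_mono' atTop (hge.mono fun n hn => ?_) tendsto_id
    simp only [id]; omega
  -- Essentially the largest gap size the colouring argument provides; then s/n → (c - 2)/4
  -- whichever way N is rounded.
  let s : ℕ → ℕ := fun n => (N n - 2 * n) / 4
  have hsn : Tendsto (fun n : ℕ => (s n : ℝ) / n) atTop (𝓝 (3.219 / 4)) := by
    refine tendsto_div_of_abs_sub_le (b := 2) ?_
    filter_upwards [hge] with n hn
    have h1 : 4 * s n + 2 * n ≤ N n := by simp only [s]; omega
    have h2 : N n ≤ 4 * s n + 2 * n + 3 := by simp only [s]; omega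
    have h1' : (4 : ℝ) * s n + 2 * n ≤ N n := by exact_mod_cast h1
    have h2' : (N n : ℝ) ≤ 4 * s n + 2 * n + 3 := by exact_mod_cast h2
    obtain ⟨h3, h4⟩ := hNb n
    norm_num at h3 h4 ⊢
    constructor <;> linarith
  have hsN : Tendsto (fun n => (s n : ℝ) / N n) atTop (𝓝 (3219 / 20876)) := by
    have h := hsn.div hNn (by norm_num)
    have e : (3.219 / 4 / 5.219 : ℝ) = 3219 / 20876 := by norm_num
    rw [e] at h
    refine h.congr' ?_
    filter_upwards [eventually_gt_atTop 0] with n hn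
    have : (n : ℝ) ≠ 0 := by exact_mod_cast hn.ne'
    exact div_div_div_cancel_right₀ this _ _
  have hgap := tendsto_gapBound hNtop hsN
  have hlow : Tendsto (fun n => 1 - ENNReal.ofReal (gapBound (N n) (s n))) atTop (𝓝 1) := by
    have h := ENNReal.Tendsto.sub (tendsto_const_nhds (x := (1 : ENNReal)))
      (ENNReal.tendsto_ofReal hgap) (Or.inl ENNReal.one_ne_top)
    simpa using h
  have hev : ∀ᶠ n in atTop, 1 - ENNReal.ofReal (gapBound (N n) (s n)) ≤
      randomRegularGraph (N n) 30 {G | Arrows G (SimpleGraph.pathGraph n) 2} ∧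
      randomRegularGraph (N n) 30 {G | Arrows G (SimpleGraph.pathGraph n) 2} ≤ 1 := by
    filter_upwards [hge, hNtop.eventually_ge_atTop 725, eventually_gt_atTop 0] with n h1 h2 h3
    exact randomRegularGraph_arrows_ge h2 h3 (by simp only [s]; omega)
  exact tendsto_of_tendsto_of_tendsto_of_le_of_le' hlow tendsto_const_nhds
    (hev.mono fun n hn => hn.1) (hev.mono fun n hn => hn.2)

theorem two_mul_ncard_edgeSet_of_regular {N d : ℕ} {G : SimpleGraph (Fin N)}
    (hG : ∀ v, Nat.card (G.neighborSet v) = d) : 2 * G.edgeSet.ncard = N * d := by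
  classical
  have h := G.sum_degrees_eq_twice_card_edges
  rw [Finset.sum_congr rfl fun v _ =>
    ((isRegularOfDegree_iff_card_neighborSet G d).2 hG) v] at h
  rw [Finset.sum_const, Finset.card_univ, Fintype.card_fin, smul_eq_mul] at h
  rw [h, ← SimpleGraph.coe_edgeFinset, Set.ncard_coe_finset]

/-- A positive probability of the arrow relation bounds the size-Ramsey number. -/
theorem mem_arrowSizes_of_randomRegularGraph_ne_zero {W : Type*} {F : SimpleGraph W} {N d r : ℕ}
    (h : randomRegularGraph N d {G | Arrows G F r} ≠ 0) :
    ∃ m ∈ arrowSizes F r, 2 * m = N * d := by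
  classical
  rw [randomRegularGraph, Ne, uniformOn_eq_zero_iff (Set.toFinite _)] at h
  obtain ⟨G, hG, hG'⟩ := Set.nonempty_iff_ne_empty.2 h
  exact ⟨_, ⟨N, G, hG', rfl⟩, two_mul_ncard_edgeSet_of_regular
    ((isRegularOfDegree_iff_card_neighborSet G d).1 hG)⟩

theorem theorem3p2 :
    (∀ N : ℕ → ℕ,
      (∀ n : ℕ, N n = ⌊(5.219 : ℝ) * (n : ℝ)⌋₊ ∨ N n = ⌈(5.219 : ℝ) * (n : ℝ)⌉₊) →
      Tendsto
        (fun n : ℕ => randomRegularGraph (N n) 30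
          {G : SimpleGraph (Fin (N n)) | Arrows G (SimpleGraph.pathGraph n) 2})
        atTop (𝓝 1)) ∧
    (∀ᶠ n : ℕ in atTop,
      (arrowSizes (SimpleGraph.pathGraph n) 2).Nonempty ∧
      (sizeRamsey (SimpleGraph.pathGraph n) 2 : ℝ) < 78.3 * (n : ℝ)) := by
  refine ⟨tendsto_randomRegularGraph_arrows, ?_⟩
  have h := tendsto_randomRegularGraph_arrows (fun n => ⌊(5.219 : ℝ) * (n : ℝ)⌋₊)
    (fun n => Or.inl rfl)
  -- A probability tending to 1 is eventually nonzero, so some 30-regular graph on ⌊5.219n⌋ vertices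
  -- has the arrow property. It has at most 78.285n edges, which is below 78.3n once n > 0.
  filter_upwards [h.eventually_ne one_ne_zero, eventually_gt_atTop 0] with n hn hn0
  obtain ⟨m, hm, hm'⟩ := mem_arrowSizes_of_randomRegularGraph_ne_zero hn
  refine ⟨⟨m, hm⟩, ?_⟩
  have hle : (sizeRamsey (SimpleGraph.pathGraph n) 2 : ℝ) ≤ m := by
    exact_mod_cast Nat.sInf_le hm
  have hfl := Nat.floor_le (show (0 : ℝ) ≤ 5.219 * n by positivity)
  have hm2 : (2 : ℝ) * m = (⌊(5.219 : ℝ) * (n : ℝ)⌋₊ : ℝ) * 30 := by exact_mod_cast hm'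
  have hn0' : (0 : ℝ) < n := by exact_mod_cast hn0
  norm_num at hfl hm2 ⊢
  linarith
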